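/- **Setting.** Let $Z$ be a square-integrable random vector in $\mathbb R^q$ and $\hat A$ a square-integrable random $q\times p$ matrix, $\mu>0$, and for $\upsilon=(\theta,z,A)\in\mathbb R^{\bar p}=\mathbb R^p\times\mathbb R^q\times\mathbb R^{q\times p}$ put $$\mathcal L(\upsilon)=-\tfrac12\|Z-z\|^2-\tfrac{\mu^2}2\|A-\hat A\|_{\rm Fr}^2-\tfrac12\|z-A\theta\|^2,\qquad \mathcal L_{\mathcal G}(\upsilon)=\mathcal L(\upsilon)-\tfrac12\|G\theta\|^2-\tfrac12\|\mathcal K A\|^2,$$ where $G$ is a $p\times p$ matrix, $\mathcal K$ a linear operator on $\mathbb R^{q\times p}$, $G^2:=G^\top G$, $\mathcal K^2:=\mathcal K^\top\mathcal K$, $\mathcal G^2=\mathrm{block}\{G^2,0,\mathcal K^2\}$. Let $f=\mathbb E\mathcal L$, $\zeta=\mathcal L-\mathbb E\mathcal L$ (so $\nabla\zeta=(0,\,Z-\mathbb EZ,\,\mu^2(\hat A-\mathbb E\hat A))$ does not depend on $\upsilon$), $\varkappa=2$. Let $\upsilon^*=(\theta^*,z^*,A^*)$ be a maximizer of $\mathbb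 E\mathcal L$ and $\upsilon^*_{\mathcal G}$ (with $\theta$-component $\theta^*_{\mathcal G}$) a maximizer of $\mathbb E\mathcal L_{\mathcal G}$. Let $D$ be a symmetric positive definite $p\times p$ matrix with $$A^{*\top}A^*\le D^2\le A^{*\top}A^*+G^2 ,$$ $N=\lambda_{\min}(D^2)$, $0<\delta_0\le 1/10$, $R=\delta_0\mu\sqrt N$, and $$\Upsilon^\circ=\{(\theta,z,A):\ \|D\theta\|\le R,\ \|z\|\le R,\ \|(A-A^*)D^{-1}\|_{\rm Fr}\le\delta_0\}.$$ Assume $\upsilon^*,\upsilon^*_{\mathcal G}\in\Upsilon^\circ$. Put $\mathcal D=\mathrm{block}\{D,I,\mu I\}$, $\tau_3=4.5\,N^{-1/2}\mu^{-1}$, $\tau_4=3N^{-1}\mu^{-2}$, $\mathscr F_{\mathcal G}=-\nabla^2f(\upsilon^*_{\mathcal G})+\mathcal G^2$, and for a covariance matrix $B$ put $z^2(B,\mathtt x)=\operatorname{tr}B+2\sqrt{\mathtt x\operatorname{tr}B^2}+2\mathtt x\|B\|$. Fix $\mathtt x>0$ and assume that for every linear mapping $S$ of $\mathbb R^{\bar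 p}$ to itself $$\mathbb P\bigl(\|S\nabla\zeta\|>z(\operatorname{Var}(S\nabla\zeta),\mathtt x)\bigr)\le 3e^{-\mathtt x}.$$ Let $\mathtt r_{\mathcal D}=z(\operatorname{Var}(\mathcal D\mathscr F_{\mathcal G}^{-1}\nabla\zeta),\mathtt x)$, $\mathsf b_{\mathcal D}=\|\mathcal D\mathscr F_{\mathcal G}^{-1}\mathcal G^2\upsilon^*\|$, and assume $$R\ge\tfrac32(\mathtt r_{\mathcal D}\vee\mathsf b_{\mathcal D}),\qquad \varkappa^2\tau_3(\mathtt r_{\mathcal D}\vee\mathsf b_{\mathcal D})<\tfrac49,\qquad \varkappa^2\tau_4(\mathtt r_{\mathcal D}\vee\mathsf b_{\mathcal D})^2<\tfrac13 .$$ Let $T(u)=\frac16\langle\nabla^3f(\upsilon^*_{\mathcal G}),u^{\otimes3}\rangle$, that is, $T(u)=-(\Delta\theta+A\alpha-h)^\top\Delta\alpha$ for $u=(\alpha,h,\Delta)$ and $\upsilon^*_{\mathcal G}=(\theta,z,A)$, and $$\phi_{\mathcal G}=\mathscr F_{\mathcal G}^{-1}\{\nabla\zeta+\nabla T(\mathscr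 F_{\mathcal G}^{-1}\nabla\zeta)\},\qquad \mu_{\mathcal G}=\mathscr F_{\mathcal G}^{-1}\{\mathcal G^2\upsilon^*+\nabla T(\mathscr F_{\mathcal G}^{-1}\mathcal G^2\upsilon^*)\}.$$ **Theorem.** The random set $\Omega(\mathtt x)=\{\|\mathcal D\mathscr F_{\mathcal G}^{-1}\nabla\zeta\|\le\mathtt r_{\mathcal D}\}$ satisfies $\mathbb P(\Omega(\mathtt x))\ge1-3e^{-\mathtt x}$. Let $Q$ be any linear mapping on $\mathbb R^p$. On $\Omega(\mathtt x)$, for every maximizer $\tilde\upsilon_{\mathcal G}\in\Upsilon^\circ$ of $\mathcal L_{\mathcal G}$, with $\theta$-component $\tilde\theta_{\mathcal G}$, $$\|Q(\tilde\theta_{\mathcal G}-\theta^*_{\mathcal G}-\phi_{\mathcal G,\theta})\|\le\|QD^{-1}\|\,\varkappa^2\Bigl(\frac{\tau_4}2+\varkappa^2\tau_3^2\Bigr)\|\mathcal D\mathscr F_{\mathcal G}^{-1}\nabla\zeta\|^3,$$ $$\|Q(\phi_{\mathcal G}-\mathscr F_{\mathcal G}^{-1}\nabla\zeta)_\theta\|\le\|QD^{-1}\|\,\frac{\varkappa^2\tau_3}2\,\|\mathcal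 D\mathscr F_{\mathcal G}^{-1}\nabla\zeta\|^2 ,$$ and moreover $$\|Q(\theta^*_{\mathcal G}-\theta^*+\mu_{\mathcal G,\theta})\|\le\|QD^{-1}\|\,\varkappa^2\Bigl(\frac{\tau_4}2+\varkappa^2\tau_3^2\Bigr)\mathsf b_{\mathcal D}^3,$$ $$\|Q(\mu_{\mathcal G}-\mathscr F_{\mathcal G}^{-1}\mathcal G^2\upsilon^*)_\theta\|\le\|QD^{-1}\|\,\frac{\varkappa^2\tau_3}2\,\mathsf b_{\mathcal D}^2 .$$ Here the maximizers $\upsilon^*,\upsilon^*_{\mathcal G},\tilde\upsilon_{\mathcal G}$ need only be points of $\Upsilon^\circ$ that are local maximizers over the full space $\mathbb R^{\bar p}$; this covers global maximizers lying in $\Upsilon^\circ$ and maximizers over $\Upsilon^\circ$ that lie in its interior. -/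

import Mathlib

open MeasureTheory ProbabilityTheory

namespace EiO

/-- The source space `ℝ^p` and the image space `ℝ^q`. -/
abbrev Vec (n : ℕ) := EuclideanSpace ℝ (Fin n)

/-- Operators `A : ℝ^p → ℝ^q` as vectors of matrix entries; the norm is the Frobenius norm. -/
abbrev Op (p q : ℕ) := EuclideanSpace ℝ (Fin q × Fin p)

/-- Index set of the full parameter `υ = (θ, z, A)`. -/
abbrev Idx (p q : ℕ) := Fin p ⊕ Fin q ⊕ (Fin q × Fin p)

/-- The full parameter space `ℝ^(p + q + p q)` with its Euclidean norm. -/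
abbrev Param (p q : ℕ) := EuclideanSpace ℝ (Idx p q)

/-- The action of a square matrix on the Euclidean space. -/
noncomputable abbrev act {n : Type*} [Fintype n] [DecidableEq n] (M : Matrix n n ℝ) :
    EuclideanSpace ℝ n →L[ℝ] EuclideanSpace ℝ n :=
  Matrix.toEuclideanCLM (n := n) (𝕜 := ℝ) M

/-- The matrix of an operator. -/
def mat {p q : ℕ} (A : Op p q) : Matrix (Fin q) (Fin p) ℝ := Matrix.of fun m j => A (m, j)

/-- The Frobenius norm of a matrix. -/
noncomputable def frob {p q : ℕ} (M : Matrix (Fin q) (Fin p) ℝ) : ℝ :=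
  √(∑ m, ∑ j, M m j ^ 2)

/-- The product `A θ`. -/
noncomputable def app {p q : ℕ} (A : Op p q) (θ : Vec p) : Vec q :=
  WithLp.toLp 2 ((mat A).mulVec θ.ofLp)

/-- The `θ`-component of a full parameter. -/
def src {p q : ℕ} (υ : Param p q) : Vec p := WithLp.toLp 2 fun j => υ (Sum.inl j)

/-- The `z`-component of a full parameter. -/
def img {p q : ℕ} (υ : Param p q) : Vec q := WithLp.toLp 2 fun m => υ (Sum.inr (Sum.inl m))

/-- The `A`-component of a full parameter. -/
def opr {p q : ℕ} (υ : Param p q) : Op p q := WithLp.toLp 2 fun k => υ (Sum.inr (Sum.inr k))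

/-- Data of the error-in-operator model: the noisy image `Z`, the pilot estimate `Ah` of the
operator, the factor `mu`, and the penalties `‖G θ‖² / 2` and `‖K A‖² / 2`. -/
structure Model (Ω : Type*) (p q : ℕ) where
  Z : Ω → Vec q
  Ah : Ω → Op p q
  mu : ℝ
  G : Matrix (Fin p) (Fin p) ℝ
  K : Matrix (Fin q × Fin p) (Fin q × Fin p) ℝ

namespace Model

variable {Ω : Type*} {p q : ℕ} (M : Model Ω p q)

/-- The log-likelihood `L(θ, z, A)` of the extended model. -/
noncomputable def L (w : Ω) (υ : Param p q) : ℝ :=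
  -(1 / 2) * ‖M.Z w - img υ‖ ^ 2 - M.mu ^ 2 / 2 * ‖opr υ - M.Ah w‖ ^ 2
    - 1 / 2 * ‖img υ - app (opr υ) (src υ)‖ ^ 2

/-- The penalized log-likelihood. -/
noncomputable def LG (w : Ω) (υ : Param p q) : ℝ :=
  M.L w υ - 1 / 2 * ‖act M.G (src υ)‖ ^ 2 - 1 / 2 * ‖act M.K (opr υ)‖ ^ 2

/-- The penalty matrix `block{G², 0, K²}` on the full parameter space. -/
noncomputable def pen2 : Matrix (Idx p q) (Idx p q) ℝ :=
  Matrix.fromBlocks (M.G.transpose * M.G) 0 0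
    (Matrix.fromBlocks 0 0 0 (M.K.transpose * M.K))

/-- The metric tensor `block{D, I, mu I}` (the square root of `block{D², I, mu² I}`). -/
noncomputable def metric (D : Matrix (Fin p) (Fin p) ℝ) : Matrix (Idx p q) (Idx p q) ℝ :=
  Matrix.fromBlocks D 0 0 (Matrix.fromBlocks 1 0 0 (M.mu • 1))

variable [MeasurableSpace Ω] (P : Measure Ω)

/-- `f(υ) = E L(υ)`. -/
noncomputable def EL (υ : Param p q) : ℝ := ∫ w, M.L w υ ∂P

/-- `E L_G(υ)`. -/
noncomputable def ELG (υ : Param p q) : ℝ := ∫ w, M.LG w υ ∂P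

/-- The score `∇ζ` of the stochastic term `ζ(υ) = L(υ) - E L(υ)`. As `ζ` is affine in `υ`, the
gradient does not depend on the point where it is taken. -/
noncomputable def score (w : Ω) : Param p q :=
  gradient (fun υ => M.L w υ - M.EL P υ) 0

/-- The information matrix `F(υ) = -∇² E L(υ)`. -/
noncomputable def info (υ : Param p q) : Matrix (Idx p q) (Idx p q) ℝ :=
  Matrix.of fun i j =>
    -(iteratedFDeriv ℝ 2 (M.EL P) υ ![EuclideanSpace.single i 1, EuclideanSpace.single j 1])

/-- The inverse `F_G(υ)⁻¹` of the penalized information matrix `F_G(υ) = F(υ) + block{G², 0, K²}`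
as an operator on the full parameter space. -/
noncomputable def infoInv (υ : Param p q) : Param p q →L[ℝ] Param p q :=
  act (M.info P υ + M.pen2)⁻¹

/-- The cubic form `T(u) = ⟨∇³ f(υ), u ⊗ u ⊗ u⟩ / 6`. -/
noncomputable def tens (υ u : Param p q) : ℝ :=
  1 / 6 * iteratedFDeriv ℝ 3 (M.EL P) υ (fun _ => u)

/-- The corrected vector `F_G⁻¹ {v + ∇T(F_G⁻¹ v)}`, with `F_G` and `T` taken at `υ`. -/
noncomputable def corrected (υ v : Param p q) : Param p q :=
  M.infoInv P υ (v + gradient (M.tens P υ) (M.infoInv P υ v))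

end Model

/-- The smallest eigenvalue of a symmetric matrix. -/
noncomputable def lambdaMin {n : ℕ} (M : Matrix (Fin n) (Fin n) ℝ) : ℝ := sInf (spectrum ℝ M)

/-- The local set `Υ°` around the operator `As`:
`‖D θ‖ ≤ R`, `‖z‖ ≤ R`, `‖(A - As) D⁻¹‖_Fr ≤ δ`. -/
def localSet {p q : ℕ} (D : Matrix (Fin p) (Fin p) ℝ) (As : Op p q) (R δ : ℝ) :
    Set (Param p q) :=
  {υ | ‖act D (src υ)‖ ≤ R ∧ ‖img υ‖ ≤ R ∧ frob ((mat (opr υ) - mat As) * D⁻¹) ≤ δ}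

section Deviation

variable {Ω : Type*} [MeasurableSpace Ω] {n : Type*} [Fintype n] [DecidableEq n]

/-- The covariance matrix `Var(X)` of a random vector. -/
noncomputable def covMat (P : Measure Ω) (X : Ω → EuclideanSpace ℝ n) : Matrix n n ℝ :=
  Matrix.of fun i j => covariance (fun w => X w i) (fun w => X w j) P

/-- The quantile bound `z(B, x)`, `z(B, x)² = tr B + 2 (x tr B²)^(1/2) + 2 x ‖B‖`. -/
noncomputable def zq (B : Matrix n n ℝ) (x : ℝ) : ℝ :=
  √(B.trace + 2 * √(x * (B * B).trace) + 2 * x * ‖act B‖)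

/-- The deviation condition on a random vector `X` with `V² = Var(X)`: for each linear mapping `S`,
`‖S X‖ ≤ z(Var(S X), x)` with probability at least `1 - 3 e^(-x)`. -/
def DeviationBound (P : Measure Ω) (X : Ω → EuclideanSpace ℝ n) (x : ℝ) : Prop :=
  ∀ S : EuclideanSpace ℝ n →L[ℝ] EuclideanSpace ℝ n,
    P.real {w | zq (covMat P fun w => S (X w)) x < ‖S (X w)‖} ≤ 3 * Real.exp (-x)

end Deviation

/-- The constant `ϰ = 2`. -/
def kap : ℝ := 2

/-- `τ₃ = 4.5 N^(-1/2) μ⁻¹`. -/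
noncomputable def tau3 (N μ : ℝ) : ℝ := 4.5 / (√N * μ)

/-- `τ₄ = 3 N⁻¹ μ⁻²`. -/
noncomputable def tau4 (N μ : ℝ) : ℝ := 3 / (N * μ ^ 2)

end EiO

/-!
The expected log-likelihood is a constant plus a linear form minus the quartic polynomial
`obj υ = ‖z‖² / 2 + μ² ‖A‖² / 2 + ‖z - A θ‖² / 2`, and both the noise and the penalty bias perturb
its stationarity equation by a fixed linear form. All expansions are therefore exact finite Taylor
expansions, with coefficients `objGrad`, `objHess`, `cubic` and `quartic`.

Lengths are measured in the metric `𝒟 = block{D, I, μ I}`, and `m = μ √N`. On a convex set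
containing the local set (`opBall`)

* the penalized negative Hessian is at least `𝒟² / 4` (`quarter_norm_sq_le_objHess`),
* the cubic and quartic parts of the gradient are bounded by `(9 / 4) / m` and `(1 / 2) / m²`
  (`abs_cubic_le`, `abs_quartic_le`), that is, by `τ₃ / 2` and `τ₄ / 6`.

Let `u` be the displacement between the two maximizers, `a` the linear perturbation, `v = F⁻¹ a`
and `k = F⁻¹ ∇T(v)`. The difference of the gradients at the end points is the mean Hessian `H` over
the segment applied to `u`, so `H u = a = F v`. Hence `H (u - v) = (F - H) v`, and `F - H` is a
third derivative at a point of the segment applied to `u`; this yields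
`‖𝒟 (u - v)‖ ≤ (9 / m) ‖𝒟 u‖ ‖𝒟 v‖`, and so `‖𝒟 u‖ ≤ (9 / 7) ‖𝒟 v‖` by the smallness condition on
`τ₃`. With `∇T` and `∇q` the cubic and quartic parts of the expansion of the gradient,
`F (u - v - k) = ∇T(u) - ∇T(v) + ∇q(u)`, and the bounds above control the right-hand side by
`‖𝒟 v‖³` (`norm_sub_expansion_le`). The constant obtained this way stays below the
one claimed because `‖𝒟 u‖` exceeds `‖𝒟 v‖` by the factor `9 / 7` at most. The localization uses only
that both maximizers lie in the convex set, not that they are global.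

The stochastic expansion is the case `a = ∇ζ`, the expansion of the bias the case `a = 𝒢² υ*`.
-/

namespace EiO

/-! ### Block coordinates of the full parameter -/

section Blocks

variable {p q : ℕ}

@[simp] lemma src_add (u v : Param p q) : src (u + v) = src u + src v := rfl
@[simp] lemma src_sub (u v : Param p q) : src (u - v) = src u - src v := rfl
@[simp] lemma src_smul (t : ℝ) (u : Param p q) : src (t • u) = t • src u := rfl
@[simp] lemma img_add (u v : Param p q) : img (u + v) = img u + img v := rfl
@[simp] lemma img_sub (u v : Param p q) : img (u - v) = img u - img v := rfl
@[simp] lemma img_smul (t : ℝ) (u : Param p q) : img (t • u) = t • img u := rfl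
@[simp] lemma opr_add (u v : Param p q) : opr (u + v) = opr u + opr v := rfl
@[simp] lemma opr_sub (u v : Param p q) : opr (u - v) = opr u - opr v := rfl
@[simp] lemma opr_smul (t : ℝ) (u : Param p q) : opr (t • u) = t • opr u := rfl

lemma app_apply (A : Op p q) (θ : Vec p) (m : Fin q) : app A θ m = ∑ j, A (m, j) * θ j := rfl

@[simp] lemma app_add_left (A B : Op p q) (θ : Vec p) : app (A + B) θ = app A θ + app B θ := by
  ext m; simp [app_apply, add_mul, Finset.sum_add_distrib]

@[simp] lemma app_add_right (A : Op p q) (θ η : Vec p) : app A (θ + η) = app A θ + app A η := by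
  ext m; simp [app_apply, mul_add, Finset.sum_add_distrib]

@[simp] lemma app_sub_left (A B : Op p q) (θ : Vec p) : app (A - B) θ = app A θ - app B θ := by
  ext m; simp [app_apply, sub_mul, Finset.sum_sub_distrib]

@[simp] lemma app_sub_right (A : Op p q) (θ η : Vec p) : app A (θ - η) = app A θ - app A η := by
  ext m; simp [app_apply, mul_sub, Finset.sum_sub_distrib]

@[simp] lemma app_smul_left (t : ℝ) (A : Op p q) (θ : Vec p) : app (t • A) θ = t • app A θ := by
  ext m; simp [app_apply, Finset.mul_sum, mul_assoc]

@[simp] lemma app_smul_right (t : ℝ) (A : Op p q) (θ : Vec p) : app A (t • θ) = t • app A θ := by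
  ext m; simp [app_apply, Finset.mul_sum, mul_left_comm]

lemma norm_app_le (A : Op p q) (θ : Vec p) : ‖app A θ‖ ≤ ‖A‖ * ‖θ‖ := by
  refine abs_le_of_sq_le_sq' ?_ (by positivity) |>.2
  rw [mul_pow, EuclideanSpace.real_norm_sq_eq, EuclideanSpace.real_norm_sq_eq,
    EuclideanSpace.real_norm_sq_eq, Fintype.sum_prod_type, Finset.sum_mul]
  refine Finset.sum_le_sum fun m _ => ?_
  rw [app_apply]
  exact Finset.sum_mul_sq_le_sq_mul_sq _ _ _

lemma inner_eq_blocks (u v : Param p q) :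
    inner ℝ u v = inner ℝ (src u) (src v) + inner ℝ (img u) (img v) + inner ℝ (opr u) (opr v) := by
  simp [PiLp.inner_apply, Fintype.sum_sum_type, src, img, opr, add_assoc]

lemma contDiff_src : ContDiff ℝ ⊤ (src : Param p q → Vec p) := by
  rw [contDiff_euclidean]; intro j
  exact (EuclideanSpace.proj (𝕜 := ℝ) (Sum.inl j : Idx p q)).contDiff

lemma contDiff_img : ContDiff ℝ ⊤ (img : Param p q → Vec q) := by
  rw [contDiff_euclidean]; intro j
  exact (EuclideanSpace.proj (𝕜 := ℝ) (Sum.inr (Sum.inl j) : Idx p q)).contDiff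

lemma contDiff_opr : ContDiff ℝ ⊤ (opr : Param p q → Op p q) := by
  rw [contDiff_euclidean]; intro j
  exact (EuclideanSpace.proj (𝕜 := ℝ) (Sum.inr (Sum.inr j) : Idx p q)).contDiff

lemma contDiff_app {E : Type*} [NormedAddCommGroup E] [NormedSpace ℝ E] {f : E → Op p q}
    {g : E → Vec p} (hf : ContDiff ℝ ⊤ f) (hg : ContDiff ℝ ⊤ g) :
    ContDiff ℝ ⊤ fun x => app (f x) (g x) := by
  rw [contDiff_euclidean] at hf hg ⊢
  intro m
  simp only [app_apply]
  exact ContDiff.sum fun j _ => (hf _).mul (hg _)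

/-! ### The residual and its polarizations -/

/-- The residual `z - A θ` of the structural relation. -/
noncomputable def res (υ : Param p q) : Vec q := img υ - app (opr υ) (src υ)

/-- The differential of the residual at `υ` in the direction `u`. -/
noncomputable def lin (υ u : Param p q) : Vec q :=
  img u - app (opr υ) (src u) - app (opr u) (src υ)

/-- The symmetric bilinear form `(Δ, α), (Δ', α') ↦ Δ α' + Δ' α`; its negative is the second
differential of the residual. -/
noncomputable def cross (u v : Param p q) : Vec q := app (opr u) (src v) + app (opr v) (src u)

lemma cross_comm (u v : Param p q) : cross u v = cross v u := add_comm _ _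

lemma cross_self (u : Param p q) : cross u u = (2 : ℝ) • app (opr u) (src u) := (two_smul _ _).symm

@[simp] lemma cross_add_right (u v w : Param p q) : cross u (v + w) = cross u v + cross u w := by
  simp [cross]; abel

@[simp] lemma cross_sub_right (u v w : Param p q) : cross u (v - w) = cross u v - cross u w := by
  simp [cross]; abel

@[simp] lemma cross_smul_right (t : ℝ) (u v : Param p q) : cross u (t • v) = t • cross u v := by
  simp [cross]

@[simp] lemma cross_add_left (u v w : Param p q) : cross (u + v) w = cross u w + cross v w := by
  simp [cross]; abel

@[simp] lemma cross_sub_left (u v w : Param p q) : cross (u - v) w = cross u w - cross v w := by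
  simp [cross]; abel

@[simp] lemma cross_smul_left (t : ℝ) (u v : Param p q) : cross (t • u) v = t • cross u v := by
  simp [cross]

@[simp] lemma lin_add (υ u v : Param p q) : lin υ (u + v) = lin υ u + lin υ v := by
  simp [lin]; abel

@[simp] lemma lin_sub (υ u v : Param p q) : lin υ (u - v) = lin υ u - lin υ v := by
  simp [lin]; abel

@[simp] lemma lin_smul (t : ℝ) (υ u : Param p q) : lin υ (t • u) = t • lin υ u := by
  simp [lin, smul_sub]

lemma lin_base_add (υ u c : Param p q) : lin (υ + u) c = lin υ c - cross u c := by
  simp [lin, cross]; abel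

lemma res_add (υ u : Param p q) :
    res (υ + u) = res υ + lin υ u - (1 / 2 : ℝ) • cross u u := by
  simp [lin, cross_self, res]; abel

/-! ### The quartic objective and its derivatives -/

/-- The part of the negative expected log-likelihood of degree at least two. -/
noncomputable def obj (μ : ℝ) (υ : Param p q) : ℝ :=
  1 / 2 * ‖img υ‖ ^ 2 + μ ^ 2 / 2 * ‖opr υ‖ ^ 2 + 1 / 2 * ‖res υ‖ ^ 2

/-- The differential of `obj` at `υ` in the direction `c`. -/
noncomputable def objGrad (μ : ℝ) (υ c : Param p q) : ℝ :=
  inner ℝ (img υ) (img c) + μ ^ 2 * inner ℝ (opr υ) (opr c) + inner ℝ (res υ) (lin υ c)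

/-- The second differential of `obj` at `υ`. -/
noncomputable def objHess (μ : ℝ) (υ u c : Param p q) : ℝ :=
  inner ℝ (img u) (img c) + μ ^ 2 * inner ℝ (opr u) (opr c) + inner ℝ (lin υ u) (lin υ c)
    - inner ℝ (res υ) (cross u c)

/-- The symmetric trilinear form `-∇³ obj(υ) / 2`. -/
noncomputable def cubic (υ u v c : Param p q) : ℝ :=
  1 / 2 * (inner ℝ (lin υ u) (cross v c) + inner ℝ (lin υ v) (cross u c)
    + inner ℝ (lin υ c) (cross u v))

/-- The fourth order part `-∇⁴ obj [u, u, u, c] / 6` of the expansion of the gradient. -/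
noncomputable def quartic (u c : Param p q) : ℝ := -(1 / 2) * inner ℝ (cross u u) (cross u c)

lemma contDiff_res : ContDiff ℝ ⊤ (res : Param p q → Vec q) :=
  contDiff_img.sub (contDiff_app contDiff_opr contDiff_src)

lemma contDiff_lin_left (c : Param p q) : ContDiff ℝ ⊤ fun υ : Param p q => lin υ c :=
  (contDiff_const.sub (contDiff_app contDiff_opr contDiff_const)).sub
    (contDiff_app contDiff_const contDiff_src)

lemma contDiff_lin_right (υ : Param p q) : ContDiff ℝ ⊤ fun c : Param p q => lin υ c :=
  (contDiff_img.sub (contDiff_app contDiff_const contDiff_src)).sub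
    (contDiff_app contDiff_opr contDiff_const)

lemma contDiff_cross_self : ContDiff ℝ ⊤ fun u : Param p q => cross u u :=
  (contDiff_app contDiff_opr contDiff_src).add (contDiff_app contDiff_opr contDiff_src)

lemma contDiff_obj (μ : ℝ) : ContDiff ℝ ⊤ (obj μ : Param p q → ℝ) :=
  ((contDiff_const.mul (contDiff_img.norm_sq ℝ)).add
    (contDiff_const.mul (contDiff_opr.norm_sq ℝ))).add
    (contDiff_const.mul (contDiff_res.norm_sq ℝ))

lemma contDiff_objGrad (μ : ℝ) (c : Param p q) :
    ContDiff ℝ ⊤ fun υ : Param p q => objGrad μ υ c :=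
  ((contDiff_img.inner ℝ contDiff_const).add
    (contDiff_const.mul (contDiff_opr.inner ℝ contDiff_const))).add
    (contDiff_res.inner ℝ (contDiff_lin_left c))

lemma contDiff_objHess (μ : ℝ) (u c : Param p q) :
    ContDiff ℝ ⊤ fun υ : Param p q => objHess μ υ u c :=
  (contDiff_const.add ((contDiff_lin_left u).inner ℝ (contDiff_lin_left c))).sub
    (contDiff_res.inner ℝ contDiff_const)

lemma objGrad_add_base (μ : ℝ) (υ u c : Param p q) :
    objGrad μ (υ + u) c
      = objGrad μ υ c + objHess μ υ u c - cubic υ u u c - quartic u c := by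
  simp only [objGrad, objHess, cubic, quartic, img_add, opr_add, res_add, lin_base_add,
    inner_add_left, inner_sub_left, inner_sub_right, real_inner_smul_left]
  rw [real_inner_comm (cross u u) (lin υ c)]
  ring

lemma obj_add (μ : ℝ) (υ u : Param p q) :
    obj μ (υ + u) = obj μ υ + objGrad μ υ u + 1 / 2 * objHess μ υ u u
      - 1 / 3 * cubic υ u u u - 1 / 4 * quartic u u := by
  simp only [obj, objGrad, objHess, cubic, quartic, img_add, opr_add, res_add,
    ← real_inner_self_eq_norm_sq, inner_add_left, inner_add_right, inner_sub_left,
    inner_sub_right, real_inner_smul_left, real_inner_smul_right]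
  rw [real_inner_comm (img υ) (img u), real_inner_comm (opr υ) (opr u),
    real_inner_comm (res υ) (lin υ u), real_inner_comm (cross u u) (lin υ u),
    real_inner_comm (cross u u) (res υ)]
  ring

lemma objHess_add_base (μ : ℝ) (υ u a c : Param p q) :
    objHess μ (υ + u) a c = objHess μ υ a c - 2 * cubic υ u a c
      + (inner ℝ (cross u a) (cross u c) + 1 / 2 * inner ℝ (cross u u) (cross a c)) := by
  simp only [objHess, cubic, res_add, lin_base_add,
    inner_add_left, inner_sub_left, inner_sub_right, real_inner_smul_left]
  rw [real_inner_comm (cross u a) (lin υ c)]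
  ring

lemma objHess_sub_left (μ : ℝ) (υ u v c : Param p q) :
    objHess μ υ (u - v) c = objHess μ υ u c - objHess μ υ v c := by
  simp only [objHess, img_sub, opr_sub, lin_sub, cross_sub_left, inner_sub_left,
    inner_sub_right]
  ring

/-- The gradient of `obj` is cubic along lines, so Simpson's rule computes the mean of the
Hessian over a segment exactly. -/
lemma objGrad_sub_eq_simpson (μ : ℝ) (υ u c : Param p q) :
    objGrad μ (υ + u) c - objGrad μ υ c
      = (objHess μ υ u c + 4 * objHess μ (υ + (1 / 2 : ℝ) • u) u c
        + objHess μ (υ + u) u c) / 6 := by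
  rw [objGrad_add_base, objHess_add_base, objHess_add_base]
  simp only [cubic, quartic, lin_smul, cross_smul_left, cross_smul_right, real_inner_smul_left,
    real_inner_smul_right]
  ring

/-- The deviation of the mean Hessian over the segment `[υ, υ + u]` from the Hessian at `υ` is
given by the third derivative at the centroid `υ + u / 3`. -/
lemma objHess_sub_simpson (μ : ℝ) (υ u v c : Param p q) :
    objHess μ υ v c - (objHess μ υ v c + 4 * objHess μ (υ + (1 / 2 : ℝ) • u) v c
        + objHess μ (υ + u) v c) / 6 = cubic (υ + (1 / 3 : ℝ) • u) u v c := by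
  rw [objHess_add_base, objHess_add_base]
  simp only [cubic, lin_smul, cross_smul_left, cross_smul_right, real_inner_smul_left,
    real_inner_smul_right, lin_base_add, inner_sub_left]
  rw [real_inner_comm (cross u v) (cross u c)]
  ring

lemma cubic_sub_diag (υ u v c : Param p q) :
    cubic υ u u c - cubic υ v v c = cubic υ (u + v) (u - v) c := by
  simp only [cubic, lin_add, lin_sub, cross_add_left, cross_sub_left, cross_sub_right,
    inner_add_left, inner_sub_left, inner_add_right, inner_sub_right]
  rw [cross_comm v u]
  ring

lemma cubic_smul_smul (υ u v c : Param p q) (s t : ℝ) :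
    cubic υ (s • u) (t • v) c = s * t * cubic υ u v c := by
  simp only [cubic, lin_smul, cross_smul_left, cross_smul_right, real_inner_smul_left,
    real_inner_smul_right]
  ring

lemma cubic_polarization (υ u v c : Param p q) :
    4 * cubic υ u v c = cubic υ (u + v) (u + v) c - cubic υ (u - v) (u - v) c := by
  simp only [cubic, lin_add, lin_sub, cross_add_left, cross_add_right, cross_sub_left,
    cross_sub_right, inner_add_left, inner_sub_left, inner_add_right, inner_sub_right]
  rw [cross_comm v u]
  ring

end Blocks

section Local

variable {p q : ℕ}

/-! ### Local bounds on the derivatives of the objective -/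

/-- A metric `Λ` on the full parameter space with `‖Λ u‖² = ‖D α‖² + ‖h‖² + μ² ‖Δ‖²` for
`u = (α, h, Δ)`, where `‖As α‖ ≤ ‖D α‖` and `m ‖α‖ ≤ μ ‖D α‖`. The number `m` plays the role of
`μ √N`, and `δ` is the relative radius of the local set. -/
structure IsLocalMetric (μ m δ : ℝ) (D : Vec p →L[ℝ] Vec p) (As : Op p q)
    (Λ : Param p q →L[ℝ] Param p q) : Prop where
  mu_pos : 0 < μ
  m_pos : 0 < m
  delta_nonneg : 0 ≤ δ
  delta_le : δ ≤ 1 / 10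
  norm_sq : ∀ u, ‖Λ u‖ ^ 2 = ‖D (src u)‖ ^ 2 + ‖img u‖ ^ 2 + (μ * ‖opr u‖) ^ 2
  coercive : ∀ α, m * ‖α‖ ≤ μ * ‖D α‖
  app_le : ∀ α, ‖app As α‖ ≤ ‖D α‖

/-- The local set with the Frobenius bound on `(A - As) D⁻¹` relaxed to an operator norm bound. -/
def opBall (m δ : ℝ) (D : Vec p →L[ℝ] Vec p) (As : Op p q) : Set (Param p q) :=
  {υ | ‖D (src υ)‖ ≤ δ * m ∧ ‖img υ‖ ≤ δ * m ∧
    ∀ α, ‖app (opr υ) α - app As α‖ ≤ δ * ‖D α‖}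

lemma norm_segment_le {V : Type*} [SeminormedAddCommGroup V] [NormedSpace ℝ V] {a b : V} {C t : ℝ}
    (ht0 : 0 ≤ t) (ht1 : t ≤ 1) (ha : ‖a‖ ≤ C) (hb : ‖b‖ ≤ C) : ‖(1 - t) • a + t • b‖ ≤ C := by
  have ht : 0 ≤ 1 - t := by linarith
  calc ‖(1 - t) • a + t • b‖ ≤ ‖(1 - t) • a‖ + ‖t • b‖ := norm_add_le _ _
    _ = (1 - t) * ‖a‖ + t * ‖b‖ := by
      rw [norm_smul, norm_smul, Real.norm_of_nonneg ht, Real.norm_of_nonneg ht0]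
    _ ≤ (1 - t) * C + t * C := by gcongr
    _ = C := by ring

lemma opBall_segment {m δ : ℝ} {D : Vec p →L[ℝ] Vec p} {As : Op p q} {υ u : Param p q}
    (h0 : υ ∈ opBall m δ D As) (h1 : υ + u ∈ opBall m δ D As) {t : ℝ} (ht0 : 0 ≤ t)
    (ht1 : t ≤ 1) : υ + t • u ∈ opBall m δ D As := by
  have hseg : υ + t • u = (1 - t) • υ + t • (υ + u) := by module
  rw [hseg]
  refine ⟨?_, ?_, fun α => ?_⟩
  · rw [src_add, src_smul, src_smul, map_add, map_smul, map_smul]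
    exact norm_segment_le ht0 ht1 h0.1 h1.1
  · rw [img_add, img_smul, img_smul]
    exact norm_segment_le ht0 ht1 h0.2.1 h1.2.1
  · have : app (opr ((1 - t) • υ + t • (υ + u))) α - app As α
        = (1 - t) • (app (opr υ) α - app As α) + t • (app (opr (υ + u)) α - app As α) := by
      rw [opr_add, opr_smul, opr_smul, app_add_left, app_smul_left, app_smul_left]
      module
    rw [this]
    exact norm_segment_le ht0 ht1 (h0.2.2 α) (h1.2.2 α)

/-- The gradient of the cubic form `(1.1 x + y + 0.1 w) x w` has norm at most `9 / 4` on the unit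
sphere. With `x = ‖D α‖`, `y = ‖h‖` and `w = μ ‖Δ‖` this form dominates `m` times the cubic part
of the expansion of the objective on the local set; the factors `1.1` and `0.1` are `1 + δ` and `δ` at
`δ = 1 / 10`. -/
lemma cubic_scalar_bound {x y w x' y' w' n k : ℝ} (hk : 0 ≤ k)
    (hn : n ^ 2 = x ^ 2 + y ^ 2 + w ^ 2) (hk2 : k ^ 2 = x' ^ 2 + y' ^ 2 + w' ^ 2) :
    (y + 11 / 10 * x + 1 / 10 * w) * (w * x' + w' * x)
      + (y' + 11 / 10 * x' + 1 / 10 * w') * (w * x) ≤ 9 / 4 * n ^ 2 * k := by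
  set a := w * (22 / 10 * x + y) + 1 / 10 * w ^ 2
  set b := x * w
  set c := x * (11 / 10 * x + y + 2 / 10 * w)
  have hx2 : x ^ 2 ≤ x ^ 2 + y ^ 2 := by nlinarith
  have ha : a ^ 2 ≤ 6424 / 1000 * w ^ 2 * (x ^ 2 + y ^ 2) + 11 / 100 * w ^ 4 := by
    have h1 : (22 / 10 * x + y) ^ 2 ≤ 584 / 100 * (x ^ 2 + y ^ 2) := by
      nlinarith [sq_nonneg (x - 22 / 10 * y)]
    have h2 : a ^ 2 ≤ 11 / 10 * (w ^ 2 * (22 / 10 * x + y) ^ 2) + 11 / 100 * w ^ 4 := by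
      have h3 := sq_nonneg (w * (22 / 10 * x + y) - w ^ 2)
      simp only [a]
      linear_combination 1 / 10 * h3
    nlinarith [mul_le_mul_of_nonneg_left h1 (sq_nonneg w)]
  have hb : b ^ 2 ≤ w ^ 2 * (x ^ 2 + y ^ 2) := by
    nlinarith [mul_le_mul_of_nonneg_left hx2 (sq_nonneg w)]
  have hc : c ^ 2 ≤ 9 / 4 * (x ^ 2 + y ^ 2) * (x ^ 2 + y ^ 2 + w ^ 2) := by
    have h1 : (11 / 10 * x + y + 2 / 10 * w) ^ 2 ≤ 9 / 4 * (x ^ 2 + y ^ 2 + w ^ 2) := by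
      nlinarith [sq_nonneg (x - 11 / 10 * y), sq_nonneg (2 / 10 * x - 11 / 10 * w),
        sq_nonneg (2 / 10 * y - w)]
    calc c ^ 2 = x ^ 2 * (11 / 10 * x + y + 2 / 10 * w) ^ 2 := by ring
      _ ≤ (x ^ 2 + y ^ 2) * (9 / 4 * (x ^ 2 + y ^ 2 + w ^ 2)) :=
        mul_le_mul hx2 h1 (sq_nonneg _) (by positivity)
      _ = _ := by ring
  have habc : a ^ 2 + b ^ 2 + c ^ 2 ≤ (9 / 4 * n ^ 2) ^ 2 := by
    rw [hn]
    nlinarith [mul_nonneg (sq_nonneg w) (add_nonneg (sq_nonneg x) (sq_nonneg y)),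
      sq_nonneg (x ^ 2 + y ^ 2), sq_nonneg (w ^ 2)]
  have hcs : (a * x' + b * y' + c * w') ^ 2 ≤ (9 / 4 * n ^ 2 * k) ^ 2 := by
    calc (a * x' + b * y' + c * w') ^ 2
        ≤ (a ^ 2 + b ^ 2 + c ^ 2) * (x' ^ 2 + y' ^ 2 + w' ^ 2) := by
          nlinarith [sq_nonneg (a * y' - b * x'), sq_nonneg (a * w' - c * x'),
            sq_nonneg (b * w' - c * y')]
      _ ≤ (9 / 4 * n ^ 2) ^ 2 * k ^ 2 := by rw [← hk2]; gcongr
      _ = _ := by ring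
  calc _ = a * x' + b * y' + c * w' := by simp only [a, b, c]; ring
    _ ≤ _ := (abs_le_of_sq_le_sq' hcs (by positivity)).2

namespace IsLocalMetric

variable {μ m δ : ℝ} {D : Vec p →L[ℝ] Vec p} {As : Op p q} {Λ : Param p q →L[ℝ] Param p q}
  (H : IsLocalMetric μ m δ D As Λ)

include H

lemma eq_zero_of_norm_eq_zero {u : Param p q} (hu : ‖Λ u‖ = 0) : u = 0 := by
  have h := H.norm_sq u
  rw [hu] at h
  have h1 : ‖D (src u)‖ = 0 := by
    nlinarith [sq_nonneg ‖D (src u)‖, sq_nonneg ‖img u‖, sq_nonneg (μ * ‖opr u‖)]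
  have h2 : ‖img u‖ = 0 := by
    nlinarith [sq_nonneg ‖D (src u)‖, sq_nonneg ‖img u‖, sq_nonneg (μ * ‖opr u‖)]
  have h3 : μ * ‖opr u‖ = 0 := by
    nlinarith [sq_nonneg ‖D (src u)‖, sq_nonneg ‖img u‖, sq_nonneg (μ * ‖opr u‖)]
  have h4 := H.coercive (src u)
  have h5 : ‖src u‖ = 0 := by
    rw [h1, mul_zero] at h4
    exact le_antisymm (nonpos_of_mul_nonpos_right h4 H.m_pos) (norm_nonneg _)
  have h6 : ‖opr u‖ = 0 := (mul_eq_zero.1 h3).resolve_left H.mu_pos.ne'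
  rw [← inner_self_eq_zero (𝕜 := ℝ), inner_eq_blocks, norm_eq_zero.1 h2, norm_eq_zero.1 h5,
    norm_eq_zero.1 h6]
  simp

lemma norm_app_mul_le (Δ : Op p q) (α : Vec p) : m * ‖app Δ α‖ ≤ μ * ‖Δ‖ * ‖D α‖ := by
  calc m * ‖app Δ α‖ ≤ m * (‖Δ‖ * ‖α‖) :=
        mul_le_mul_of_nonneg_left (norm_app_le _ _) H.m_pos.le
    _ = ‖Δ‖ * (m * ‖α‖) := by ring
    _ ≤ ‖Δ‖ * (μ * ‖D α‖) := mul_le_mul_of_nonneg_left (H.coercive α) (norm_nonneg _)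
    _ = _ := by ring

lemma norm_cross_mul_le (u c : Param p q) :
    m * ‖cross u c‖ ≤ μ * ‖opr u‖ * ‖D (src c)‖ + μ * ‖opr c‖ * ‖D (src u)‖ := by
  calc m * ‖cross u c‖ ≤ m * (‖app (opr u) (src c)‖ + ‖app (opr c) (src u)‖) :=
        mul_le_mul_of_nonneg_left (norm_add_le _ _) H.m_pos.le
    _ ≤ _ := by rw [mul_add]; exact add_le_add (H.norm_app_mul_le _ _) (H.norm_app_mul_le _ _)

lemma norm_app_sub_le {υ : Param p q} (hυ : υ ∈ opBall m δ D As) (α : Vec p) :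
    ‖app (opr υ) α - app As α‖ ≤ 1 / 10 * ‖D α‖ :=
  (hυ.2.2 α).trans (mul_le_mul_of_nonneg_right H.delta_le (norm_nonneg _))

lemma norm_app_opr_le {υ : Param p q} (hυ : υ ∈ opBall m δ D As) (α : Vec p) :
    ‖app (opr υ) α‖ ≤ 11 / 10 * ‖D α‖ := by
  have h := norm_add_le (app (opr υ) α - app As α) (app As α)
  rw [sub_add_cancel] at h
  linarith [H.norm_app_sub_le hυ α, H.app_le α]

lemma norm_app_src_le {υ : Param p q} (hυ : υ ∈ opBall m δ D As) (Δ : Op p q) :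
    ‖app Δ (src υ)‖ ≤ 1 / 10 * (μ * ‖Δ‖) := by
  have hw : 0 ≤ μ * ‖Δ‖ := mul_nonneg H.mu_pos.le (norm_nonneg _)
  have h1 := H.norm_app_mul_le Δ (src υ)
  have h2 : μ * ‖Δ‖ * ‖D (src υ)‖ ≤ μ * ‖Δ‖ * (1 / 10 * m) :=
    mul_le_mul_of_nonneg_left
      (hυ.1.trans (mul_le_mul_of_nonneg_right H.delta_le H.m_pos.le)) hw
  refine le_of_mul_le_mul_left (h1.trans (h2.trans_eq ?_)) H.m_pos
  ring

lemma norm_lin_le {υ : Param p q} (hυ : υ ∈ opBall m δ D As) (u : Param p q) :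
    ‖lin υ u‖ ≤ ‖img u‖ + 11 / 10 * ‖D (src u)‖ + 1 / 10 * (μ * ‖opr u‖) := by
  have h1 := norm_sub_le (img u - app (opr υ) (src u)) (app (opr u) (src υ))
  have h2 := norm_sub_le (img u) (app (opr υ) (src u))
  have h3 := H.norm_app_opr_le hυ (src u)
  have h4 := H.norm_app_src_le hυ (opr u)
  unfold lin
  linarith

lemma norm_res_le {υ : Param p q} (hυ : υ ∈ opBall m δ D As) : ‖res υ‖ ≤ 21 / 100 * m := by
  have h1 := norm_sub_le (img υ) (app (opr υ) (src υ))
  have h2 := H.norm_app_opr_le hυ (src υ)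
  have h3 : δ * m ≤ 1 / 10 * m := mul_le_mul_of_nonneg_right H.delta_le H.m_pos.le
  have h4 := hυ.1
  have h5 := hυ.2.1
  unfold res
  linarith

/-- On the local set the penalized Hessian dominates a quarter of the squared metric. The
number `g` stands for `‖G α‖²`. -/
lemma quarter_norm_sq_le_objHess {υ : Param p q} (hυ : υ ∈ opBall m δ D As) (u : Param p q)
    {g : ℝ} (hg : 0 ≤ g) (hgD : ‖D (src u)‖ ^ 2 ≤ ‖app As (src u)‖ ^ 2 + g) :
    1 / 4 * ‖Λ u‖ ^ 2 ≤ objHess μ υ u u + g := by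
  have hx := norm_nonneg (D (src u))
  have hw : 0 ≤ μ * ‖opr u‖ := mul_nonneg H.mu_pos.le (norm_nonneg _)
  have hs := norm_nonneg (app As (src u))
  have hsx := H.app_le (src u)
  set c := app (opr υ) (src u) + app (opr u) (src υ) with hc
  have hlin : lin υ u = img u - c := by rw [hc, lin, sub_sub]
  have he : ‖c - app As (src u)‖ ≤ 1 / 10 * (‖D (src u)‖ + μ * ‖opr u‖) := by
    have h1 : c - app As (src u)
        = (app (opr υ) (src u) - app As (src u)) + app (opr u) (src υ) := by rw [hc]; abel
    have h2 := norm_add_le (app (opr υ) (src u) - app As (src u)) (app (opr u) (src υ))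
    rw [h1]
    linarith [H.norm_app_sub_le hυ (src u), H.norm_app_src_le hυ (opr u)]
  have hcs : ‖app As (src u)‖ ^ 2
      - 2 / 10 * ‖D (src u)‖ * (‖D (src u)‖ + μ * ‖opr u‖) ≤ ‖c‖ ^ 2 := by
    have h1 : ‖c‖ ^ 2 = ‖app As (src u)‖ ^ 2
        + 2 * inner ℝ (app As (src u)) (c - app As (src u)) + ‖c - app As (src u)‖ ^ 2 := by
      rw [← norm_add_sq_real, add_sub_cancel]
    have h2 := neg_le_of_abs_le (abs_real_inner_le_norm (app As (src u)) (c - app As (src u)))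
    have h3 := mul_le_mul hsx he (norm_nonneg _) hx
    nlinarith [sq_nonneg ‖c - app As (src u)‖]
  -- Minimizing over `h` leaves `3 / 7` of `‖c‖²`.
  have hmin : 3 / 7 * ‖c‖ ^ 2 ≤ 3 / 4 * ‖img u‖ ^ 2 + ‖lin υ u‖ ^ 2 := by
    have h1 := sq_nonneg ‖(7 / 4 : ℝ) • img u - c‖
    rw [norm_sub_sq_real, norm_smul, real_inner_smul_left, mul_pow, Real.norm_of_nonneg
      (by norm_num)] at h1
    rw [hlin, norm_sub_sq_real]
    linarith
  have hres : inner ℝ (res υ) (cross u u) ≤ 42 / 100 * (μ * ‖opr u‖ * ‖D (src u)‖) := by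
    have h1 := real_inner_le_norm (res υ) (cross u u)
    have h2 := H.norm_cross_mul_le u u
    have h3 := mul_le_mul_of_nonneg_right (H.norm_res_le hυ) (norm_nonneg (cross u u))
    nlinarith
  -- What remains is `0.0928 x² - 0.5058 x w + 0.75 w² ≥ 0`, a form of negative discriminant.
  rw [H.norm_sq, objHess, real_inner_self_eq_norm_sq, real_inner_self_eq_norm_sq,
    real_inner_self_eq_norm_sq]
  nlinarith [sq_nonneg (‖D (src u)‖ - 272 / 100 * (μ * ‖opr u‖)), sq_nonneg (μ * ‖opr u‖)]

lemma abs_cubic_diag_le {υ : Param p q} (hυ : υ ∈ opBall m δ D As) (u c : Param p q) :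
    m * |cubic υ u u c| ≤ 9 / 4 * ‖Λ u‖ ^ 2 * ‖Λ c‖ := by
  have hw : 0 ≤ μ * ‖opr u‖ := mul_nonneg H.mu_pos.le (norm_nonneg _)
  have hw' : 0 ≤ μ * ‖opr c‖ := mul_nonneg H.mu_pos.le (norm_nonneg _)
  have hm := H.m_pos
  have h0 : cubic υ u u c
      = inner ℝ (lin υ u) (cross u c) + inner ℝ (lin υ c) (app (opr u) (src u)) := by
    rw [cubic, cross_self, real_inner_smul_right]; ring
  have h1 := mul_le_mul (H.norm_lin_le hυ u) (H.norm_cross_mul_le u c)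
    (mul_nonneg hm.le (norm_nonneg _)) (by positivity)
  have h2 := mul_le_mul (H.norm_lin_le hυ c) (H.norm_app_mul_le (opr u) (src u))
    (mul_nonneg hm.le (norm_nonneg _)) (by positivity)
  calc m * |cubic υ u u c|
      ≤ m * (‖lin υ u‖ * ‖cross u c‖ + ‖lin υ c‖ * ‖app (opr u) (src u)‖) := by
        rw [h0]
        refine mul_le_mul_of_nonneg_left ((abs_add_le _ _).trans ?_) hm.le
        exact add_le_add (abs_real_inner_le_norm _ _) (abs_real_inner_le_norm _ _)
    _ = ‖lin υ u‖ * (m * ‖cross u c‖) + ‖lin υ c‖ * (m * ‖app (opr u) (src u)‖) := by ring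
    _ ≤ _ := add_le_add h1 h2
    _ ≤ _ := cubic_scalar_bound (norm_nonneg _)
        (H.norm_sq u) (H.norm_sq c)

/-- The bound on the diagonal extends to all arguments by polarization. -/
lemma abs_cubic_le {υ : Param p q} (hυ : υ ∈ opBall m δ D As) (u v c : Param p q) :
    m * |cubic υ u v c| ≤ 9 / 4 * ‖Λ u‖ * ‖Λ v‖ * ‖Λ c‖ := by
  have hm := H.m_pos
  have key : ∀ a b : Param p q,
      m * |cubic υ a b c| ≤ 9 / 8 * (‖Λ a‖ ^ 2 + ‖Λ b‖ ^ 2) * ‖Λ c‖ := by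
    intro a b
    have h1 := H.abs_cubic_diag_le hυ (a + b) c
    have h2 := H.abs_cubic_diag_le hυ (a - b) c
    have h3 : 4 * |cubic υ a b c|
        ≤ |cubic υ (a + b) (a + b) c| + |cubic υ (a - b) (a - b) c| := by
      rw [show 4 * |cubic υ a b c| = |4 * cubic υ a b c| by rw [abs_mul]; norm_num,
        cubic_polarization]
      exact abs_sub _ _
    have h4 := parallelogram_law_with_norm ℝ (Λ a) (Λ b)
    rw [← map_add, ← map_sub] at h4
    have h5 : ‖Λ (a + b)‖ ^ 2 + ‖Λ (a - b)‖ ^ 2 = 2 * (‖Λ a‖ ^ 2 + ‖Λ b‖ ^ 2) := by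
      nlinarith
    have h6 : 9 / 4 * ‖Λ (a + b)‖ ^ 2 * ‖Λ c‖ + 9 / 4 * ‖Λ (a - b)‖ ^ 2 * ‖Λ c‖
        = 9 / 4 * (2 * (‖Λ a‖ ^ 2 + ‖Λ b‖ ^ 2)) * ‖Λ c‖ := by rw [← h5]; ring
    nlinarith [mul_le_mul_of_nonneg_left h3 hm.le]
  rcases (norm_nonneg (Λ u)).eq_or_lt with hu | hu
  · rw [H.eq_zero_of_norm_eq_zero hu.symm]
    have h := cubic_smul_smul υ u v c 0 1
    rw [zero_smul, one_smul, zero_mul, zero_mul] at h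
    simp [h]
  rcases (norm_nonneg (Λ v)).eq_or_lt with hv | hv
  · rw [H.eq_zero_of_norm_eq_zero hv.symm]
    have h := cubic_smul_smul υ u v c 1 0
    rw [zero_smul, one_smul, mul_zero, zero_mul] at h
    simp [h]
  have h := key (‖Λ v‖ • u) (‖Λ u‖ • v)
  rw [cubic_smul_smul, abs_mul, abs_of_nonneg (by positivity), map_smul, map_smul, norm_smul,
    norm_smul, norm_norm, norm_norm] at h
  refine le_of_mul_le_mul_left ?_ (mul_pos hu hv)
  nlinarith

lemma abs_quartic_le (u c : Param p q) :
    m ^ 2 * |quartic u c| ≤ 1 / 2 * ‖Λ u‖ ^ 3 * ‖Λ c‖ := by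
  have hm := H.m_pos
  have hx := norm_nonneg (D (src u))
  have hx' := norm_nonneg (D (src c))
  have hw : 0 ≤ μ * ‖opr u‖ := mul_nonneg H.mu_pos.le (norm_nonneg _)
  have hw' : 0 ≤ μ * ‖opr c‖ := mul_nonneg H.mu_pos.le (norm_nonneg _)
  have h1 := H.norm_cross_mul_le u u
  have h2 := H.norm_cross_mul_le u c
  have hn := H.norm_sq u
  have hk := H.norm_sq c
  set x := ‖D (src u)‖
  set w := μ * ‖opr u‖
  set x' := ‖D (src c)‖
  set w' := μ * ‖opr c‖
  have h3 : w * x' + w' * x ≤ ‖Λ u‖ * ‖Λ c‖ := by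
    refine (abs_le_of_sq_le_sq' ?_ (by positivity)).2
    rw [mul_pow, hn, hk]
    nlinarith [sq_nonneg (w * w' - x * x'), mul_nonneg (sq_nonneg ‖img u‖) (sq_nonneg x'),
      mul_nonneg (sq_nonneg ‖img u‖) (sq_nonneg w'), mul_nonneg (sq_nonneg ‖img c‖) (sq_nonneg x),
      mul_nonneg (sq_nonneg ‖img c‖) (sq_nonneg w),
      mul_nonneg (sq_nonneg ‖img u‖) (sq_nonneg ‖img c‖)]
  have h4 : m * ‖cross u u‖ ≤ ‖Λ u‖ ^ 2 := by
    rw [hn]; nlinarith [sq_nonneg (w - x), sq_nonneg ‖img u‖]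
  have h5 := mul_le_mul h4 (h2.trans h3) (by positivity) (by positivity)
  have h6 := abs_real_inner_le_norm (cross u u) (cross u c)
  rw [quartic, abs_mul, abs_neg, abs_of_pos (by norm_num : (0 : ℝ) < 1 / 2)]
  nlinarith [mul_le_mul_of_nonneg_left h6 (sq_nonneg m)]

/-! ### The abstract expansion -/

/-- The expansion of a maximizer under a linear perturbation. Here `pen` is the penalty form, `u`
the displacement of the maximizer caused by the linear perturbation `a`, `v` the first order
approximation of `u`, and `k` its second order correction. As Hessians dominate `Λ² / 4` and the
cubic part is bounded by `(9 / 4) / m`, solving an equation with a cubic right-hand side costs the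
factor `9 / m = 4 (9 / 4) / m`. The assumption `hsmall` makes `(9 / m) ‖Λ v‖` at most `2 / 9`. -/
theorem norm_sub_expansion_le {pen : Param p q → Param p q → ℝ}
    (pen_sub : ∀ u v c, pen (u - v) c = pen u c - pen v c)
    (hpen : ∀ υ ∈ opBall m δ D As, ∀ u, 1 / 4 * ‖Λ u‖ ^ 2 ≤ objHess μ υ u u + pen u u)
    {υ u v k : Param p q} {a : Param p q → ℝ}
    (hυ : υ ∈ opBall m δ D As) (hυu : υ + u ∈ opBall m δ D As)
    (hgrad : ∀ c, objGrad μ (υ + u) c - objGrad μ υ c + pen u c = a c)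
    (hv : ∀ c, objHess μ υ v c + pen v c = a c)
    (hk : ∀ c, objHess μ υ k c + pen k c = cubic υ v v c)
    (hsmall : 81 / 2 * ‖Λ v‖ ≤ m) :
    m ^ 2 * ‖Λ (u - v - k)‖ ≤ 330 * ‖Λ v‖ ^ 3 := by
  have hm := H.m_pos
  have hU := norm_nonneg (Λ u)
  have hS := norm_nonneg (Λ v)
  have half : ∀ x y z : Param p q, ∀ (υ' : Param p q),
      objHess μ υ' (x - y) z + pen (x - y) z
        = (objHess μ υ' x z + pen x z) - (objHess μ υ' y z + pen y z) := by
    intro x y z υ'; rw [objHess_sub_left, pen_sub]; ring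
  have hmid : υ + (1 / 2 : ℝ) • u ∈ opBall m δ D As :=
    opBall_segment hυ hυu (by norm_num) (by norm_num)
  have hthird : υ + (1 / 3 : ℝ) • u ∈ opBall m δ D As :=
    opBall_segment hυ hυu (by norm_num) (by norm_num)
  -- The mean Hessian over the segment maps `u` to `a`, the Hessian at `υ` maps `v` to `a`.
  have hd : m * ‖Λ (u - v)‖ ≤ 9 * ‖Λ u‖ * ‖Λ v‖ := by
    set d := u - v with hd
    have h0 := hpen υ hυ d
    have h1 := hpen _ hmid d
    have h2 := hpen _ hυu d
    rw [hd, half u v] at h0 h1 h2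
    rw [← hd] at h0 h1 h2
    have h3 := objGrad_sub_eq_simpson μ υ u d
    have h4 := objHess_sub_simpson μ υ u v d
    have h5 := hgrad d
    have h6 := hv d
    have h7 : 1 / 4 * ‖Λ d‖ ^ 2 ≤ cubic (υ + (1 / 3 : ℝ) • u) u v d := by linarith
    have h8 := H.abs_cubic_le hthird u v d
    have h9 := mul_le_mul_of_nonneg_left (h7.trans (le_abs_self _)) hm.le
    rcases (norm_nonneg (Λ d)).eq_or_lt with hd0 | hd0
    · rw [← hd0]; nlinarith [mul_nonneg hU hS]
    · refine le_of_mul_le_mul_right ?_ hd0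
      nlinarith
  have hUS : ‖Λ u‖ ≤ 9 / 7 * ‖Λ v‖ := by
    have h1 : ‖Λ u‖ ≤ ‖Λ (u - v)‖ + ‖Λ v‖ := by
      have := norm_add_le (Λ (u - v)) (Λ v)
      rwa [← map_add, sub_add_cancel] at this
    have h2 : m * ‖Λ (u - v)‖ ≤ m * (2 / 9 * ‖Λ u‖) := by
      nlinarith [mul_le_mul_of_nonneg_left hsmall hU]
    have h3 := le_of_mul_le_mul_left h2 hm
    linarith
  have hdS : m * ‖Λ (u - v)‖ ≤ 81 / 7 * ‖Λ v‖ ^ 2 := by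
    nlinarith [mul_le_mul_of_nonneg_right hUS hS]
  have hsum : ‖Λ (u + v)‖ ≤ 16 / 7 * ‖Λ v‖ := by
    rw [map_add]
    linarith [norm_add_le (Λ u) (Λ v)]
  have hU3 : ‖Λ u‖ ^ 3 ≤ (9 / 7 * ‖Λ v‖) ^ 3 := pow_le_pow_left₀ hU hUS 3
  -- At `υ`, the Hessian maps `e` to the increment of the cubic part from `v` to `u` plus the quartic
  -- part at `u`.
  set e := u - v - k with he
  have h1 := hpen υ hυ e
  rw [he, half, half, ← he] at h1
  have h2 := hgrad e
  have h3 := hv e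
  have h4 := hk e
  rw [objGrad_add_base] at h2
  have h5 := cubic_sub_diag υ u v e
  have h6 : 1 / 4 * ‖Λ e‖ ^ 2 ≤ cubic υ (u + v) (u - v) e + quartic u e := by linarith
  have h7 := H.abs_cubic_le hυ (u + v) (u - v) e
  have h8 := H.abs_quartic_le u e
  have h9 : m ^ 2 * (1 / 4 * ‖Λ e‖ ^ 2)
      ≤ m * (m * |cubic υ (u + v) (u - v) e|) + m ^ 2 * |quartic u e| := by
    have := h6.trans (add_le_add (le_abs_self _) (le_abs_self _))
    nlinarith [mul_le_mul_of_nonneg_left this (sq_nonneg m)]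
  have h10 : m * (m * |cubic υ (u + v) (u - v) e|)
      ≤ 9 / 4 * (16 / 7 * ‖Λ v‖) * (81 / 7 * ‖Λ v‖ ^ 2) * ‖Λ e‖ := by
    calc m * (m * |cubic υ (u + v) (u - v) e|)
        ≤ m * (9 / 4 * ‖Λ (u + v)‖ * ‖Λ (u - v)‖ * ‖Λ e‖) :=
          mul_le_mul_of_nonneg_left h7 hm.le
      _ = 9 / 4 * ‖Λ (u + v)‖ * (m * ‖Λ (u - v)‖) * ‖Λ e‖ := by ring
      _ ≤ _ := by gcongr
  have h11 : 1 / 2 * ‖Λ u‖ ^ 3 * ‖Λ e‖ ≤ 1 / 2 * (9 / 7 * ‖Λ v‖) ^ 3 * ‖Λ e‖ := by gcongr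
  rcases (norm_nonneg (Λ e)).eq_or_lt with he0 | he0
  · rw [← he0, mul_zero]; positivity
  · refine le_of_mul_le_mul_right ?_ he0
    have h12 : 0 ≤ ‖Λ v‖ ^ 3 * ‖Λ e‖ := by positivity
    nlinarith

lemma norm_correction_le {pen : Param p q → Param p q → ℝ}
    (hpen : ∀ υ ∈ opBall m δ D As, ∀ u, 1 / 4 * ‖Λ u‖ ^ 2 ≤ objHess μ υ u u + pen u u)
    {υ v k : Param p q} (hυ : υ ∈ opBall m δ D As)
    (hk : ∀ c, objHess μ υ k c + pen k c = cubic υ v v c) :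
    m * ‖Λ k‖ ≤ 9 * ‖Λ v‖ ^ 2 := by
  have h1 := (hpen υ hυ k).trans ((hk k).le.trans (le_abs_self _))
  have h2 := H.abs_cubic_diag_le hυ v k
  have h3 := mul_le_mul_of_nonneg_left h1 H.m_pos.le
  rcases (norm_nonneg (Λ k)).eq_or_lt with hk0 | hk0
  · rw [← hk0, mul_zero]; positivity
  · refine le_of_mul_le_mul_right ?_ hk0
    nlinarith

end IsLocalMetric

end Local

/-! ### Block matrices and the smallest eigenvalue -/

section Matrices

variable {Ω : Type*} {p q : ℕ} (M : Model Ω p q)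

lemma src_metric (D : Matrix (Fin p) (Fin p) ℝ) (u : Param p q) :
    src (act (M.metric D) u) = act D (src u) := by
  ext j
  simp [src, Model.metric, Matrix.fromBlocks_mulVec, Matrix.ofLp_toEuclideanCLM]
  rfl

lemma img_metric (D : Matrix (Fin p) (Fin p) ℝ) (u : Param p q) :
    img (act (M.metric D) u) = img u := by
  ext j
  simp [img, Model.metric, Matrix.fromBlocks_mulVec, Matrix.ofLp_toEuclideanCLM]

lemma opr_metric (D : Matrix (Fin p) (Fin p) ℝ) (u : Param p q) :
    opr (act (M.metric D) u) = M.mu • opr u := by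
  ext j
  simp [opr, Model.metric, Matrix.fromBlocks_mulVec, Matrix.ofLp_toEuclideanCLM,
    Matrix.smul_mulVec]

lemma norm_sq_metric (D : Matrix (Fin p) (Fin p) ℝ) (u : Param p q) :
    ‖act (M.metric D) u‖ ^ 2
      = ‖act D (src u)‖ ^ 2 + ‖img u‖ ^ 2 + (M.mu * ‖opr u‖) ^ 2 := by
  rw [← real_inner_self_eq_norm_sq, inner_eq_blocks, src_metric, img_metric, opr_metric]
  simp only [real_inner_self_eq_norm_sq, norm_smul, mul_pow, Real.norm_eq_abs, sq_abs]

lemma act_add_apply {n : Type*} [Fintype n] [DecidableEq n] (A B : Matrix n n ℝ)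
    (u : EuclideanSpace ℝ n) : act (A + B) u = act A u + act B u := by
  unfold act
  rw [map_add, add_apply]

lemma act_sub_apply {n : Type*} [Fintype n] [DecidableEq n] (A B : Matrix n n ℝ)
    (u : EuclideanSpace ℝ n) : act (A - B) u = act A u - act B u := by
  unfold act
  rw [map_sub, sub_apply]

lemma act_algebraMap_apply {n : Type*} [Fintype n] [DecidableEq n] (t : ℝ)
    (u : EuclideanSpace ℝ n) : act (algebraMap ℝ (Matrix n n ℝ) t) u = t • u := by
  unfold act
  rw [Algebra.algebraMap_eq_smul_one, map_smul, map_one, smul_apply, one_apply_eq_self]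

lemma inner_act_gram {n : Type*} [Fintype n] [DecidableEq n] (B : Matrix n n ℝ)
    (u v : EuclideanSpace ℝ n) :
    inner ℝ (act (B.transpose * B) u) v = inner ℝ (act B u) (act B v) := by
  rw [real_inner_comm, real_inner_comm (act B v), Matrix.inner_toEuclideanCLM,
    Matrix.inner_toEuclideanCLM, Matrix.ofLp_toEuclideanCLM, ← Matrix.mulVec_mulVec,
    Matrix.dotProduct_mulVec, Matrix.vecMul_transpose]

lemma src_pen2 (u : Param p q) : src (act M.pen2 u) = act (M.G.transpose * M.G) (src u) := by
  ext j
  simp [src, Model.pen2, Matrix.fromBlocks_mulVec, Matrix.ofLp_toEuclideanCLM]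
  rfl

lemma img_pen2 (u : Param p q) : img (act M.pen2 u) = 0 := by
  ext j
  simp [img, Model.pen2, Matrix.fromBlocks_mulVec, Matrix.ofLp_toEuclideanCLM]

lemma opr_pen2 (u : Param p q) : opr (act M.pen2 u) = act (M.K.transpose * M.K) (opr u) := by
  ext j
  simp [opr, Model.pen2, Matrix.fromBlocks_mulVec, Matrix.ofLp_toEuclideanCLM]
  rfl

lemma inner_pen2 (u c : Param p q) :
    inner ℝ (act M.pen2 u) c
      = inner ℝ (act M.G (src u)) (act M.G (src c))
        + inner ℝ (act M.K (opr u)) (act M.K (opr c)) := by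
  rw [inner_eq_blocks, src_pen2, img_pen2, opr_pen2, inner_act_gram, inner_act_gram]
  simp

lemma lambdaMin_pos {p : ℕ} [NeZero p] {A : Matrix (Fin p) (Fin p) ℝ} (hA : A.PosDef) :
    0 < lambdaMin A := by
  have hs := hA.isHermitian.spectrum_real_eq_range_eigenvalues
  have hmem : lambdaMin A ∈ spectrum ℝ A := by
    refine Set.Nonempty.csInf_mem ?_ ?_ <;> rw [hs]
    · exact Set.range_nonempty _
    · exact Set.finite_range _
  rw [hs] at hmem
  obtain ⟨i, hi⟩ := hmem
  rw [← hi]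
  exact hA.eigenvalues_pos i

lemma posSemidef_sub_lambdaMin {p : ℕ} {A : Matrix (Fin p) (Fin p) ℝ} (hA : A.IsHermitian) :
    (A - algebraMap ℝ _ (lambdaMin A)).PosSemidef := by
  rw [Matrix.posSemidef_iff_isHermitian_and_spectrum_nonneg]
  refine ⟨hA.sub ?_, ?_⟩
  · rw [Algebra.algebraMap_eq_smul_one]
    exact Matrix.isHermitian_one.smul (by simp [IsSelfAdjoint])
  · rw [← spectrum.sub_singleton_eq]
    rintro _ ⟨a, ha, b, rfl, rfl⟩
    have hbdd : BddBelow (spectrum ℝ A) := A.finite_real_spectrum.bddBelow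
    exact sub_nonneg.2 (csInf_le hbdd ha)

lemma inner_act_nonneg {n : Type*} [Fintype n] [DecidableEq n] {B : Matrix n n ℝ}
    (hB : B.PosSemidef) (u : EuclideanSpace ℝ n) : 0 ≤ inner ℝ (act B u) u := by
  rw [real_inner_comm, Matrix.inner_toEuclideanCLM]
  simpa using hB.dotProduct_mulVec_nonneg u.ofLp

lemma inner_act_gram_mat (A : Op p q) (α : Vec p) :
    inner ℝ (act ((mat A).transpose * mat A) α) α = ‖app A α‖ ^ 2 := by
  rw [real_inner_comm, Matrix.inner_toEuclideanCLM, ← Matrix.mulVec_mulVec,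
    Matrix.dotProduct_mulVec, Matrix.vecMul_transpose, ← real_inner_self_eq_norm_sq,
    EuclideanSpace.inner_eq_star_dotProduct]
  simp [app]

lemma norm_app_le_frob (B : Matrix (Fin q) (Fin p) ℝ) (α : Vec p) :
    ‖(WithLp.toLp 2 (B.mulVec α.ofLp) : Vec q)‖ ≤ frob B * ‖α‖ := by
  have h : frob B = ‖(WithLp.toLp 2 (fun k => B k.1 k.2) : Op p q)‖ := by
    rw [EuclideanSpace.norm_eq, frob, Fintype.sum_prod_type]
    simp
  rw [h]
  exact norm_app_le (WithLp.toLp 2 (fun k => B k.1 k.2) : Op p q) α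

lemma act_inv_act {n : Type*} [Fintype n] [DecidableEq n] {B : Matrix n n ℝ} (hB : IsUnit B)
    (u : EuclideanSpace ℝ n) : act B⁻¹ (act B u) = u := by
  have h : B⁻¹ * B = 1 := Matrix.nonsing_inv_mul _ ((Matrix.isUnit_iff_isUnit_det _).1 hB)
  rw [← mul_apply_eq_comp, ← map_mul, h, map_one, one_apply_eq_self]

lemma act_act_inv {n : Type*} [Fintype n] [DecidableEq n] {B : Matrix n n ℝ} (hB : IsUnit B)
    (u : EuclideanSpace ℝ n) : act B (act B⁻¹ u) = u := by
  have h : B * B⁻¹ = 1 := Matrix.mul_nonsing_inv _ ((Matrix.isUnit_iff_isUnit_det _).1 hB)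
  rw [← mul_apply_eq_comp, ← map_mul, h, map_one, one_apply_eq_self]

lemma localSet_subset_opBall {D : Matrix (Fin p) (Fin p) ℝ} (hD : IsUnit D) {As : Op p q}
    {m δ : ℝ} : localSet D As (δ * m) δ ⊆ opBall m δ (act D) As := by
  rintro υ ⟨h1, h2, h3⟩
  refine ⟨h1, h2, fun α => ?_⟩
  have h4 := norm_app_le_frob ((mat (opr υ) - mat As) * D⁻¹) (act D α)
  have h5 : (WithLp.toLp 2 (((mat (opr υ) - mat As) * D⁻¹).mulVec (act D α).ofLp) : Vec q)
      = app (opr υ) α - app As α := by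
    rw [← Matrix.mulVec_mulVec]
    have h6 : D⁻¹.mulVec (act D α).ofLp = α.ofLp := congrArg WithLp.ofLp (act_inv_act hD α)
    rw [h6, Matrix.sub_mulVec]
    rfl
  rw [h5] at h4
  exact h4.trans (mul_le_mul_of_nonneg_right h3 (norm_nonneg _))

end Matrices

/-! ### Derivatives along lines -/

section Calculus

lemma hasDerivAt_quartic_zero (a₀ a₁ a₂ a₃ a₄ : ℝ) :
    HasDerivAt (fun t : ℝ => a₀ + t * a₁ + t ^ 2 * a₂ + t ^ 3 * a₃ + t ^ 4 * a₄) a₁ 0 := by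
  have h := (((((hasDerivAt_id (0 : ℝ)).mul_const a₁).const_add a₀).add
    ((hasDerivAt_pow 2 (0 : ℝ)).mul_const a₂)).add
    ((hasDerivAt_pow 3 (0 : ℝ)).mul_const a₃)).add ((hasDerivAt_pow 4 (0 : ℝ)).mul_const a₄)
  exact h.congr_deriv (by simp)

lemma fderiv_apply_eq_of_quartic {E : Type*} [NormedAddCommGroup E] [NormedSpace ℝ E]
    {f : E → ℝ} {x c : E} (hf : DifferentiableAt ℝ f x) {a₁ a₂ a₃ a₄ : ℝ}
    (h : ∀ t : ℝ, f (x + t • c) = f x + t * a₁ + t ^ 2 * a₂ + t ^ 3 * a₃ + t ^ 4 * a₄) :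
    fderiv ℝ f x c = a₁ := by
  have h1 := hf.hasFDerivAt.hasLineDerivAt c
  have h2 := hasDerivAt_quartic_zero (f x) a₁ a₂ a₃ a₄
  simp only [HasLineDerivAt, h] at h1
  exact h1.unique h2

variable {p q : ℕ}

lemma obj_add_smul (μ : ℝ) (υ u : Param p q) (t : ℝ) :
    obj μ (υ + t • u) = obj μ υ + t * objGrad μ υ u + t ^ 2 * (1 / 2 * objHess μ υ u u)
      + t ^ 3 * (-(1 / 3) * cubic υ u u u) + t ^ 4 * (-(1 / 4) * quartic u u) := by
  rw [obj_add]
  simp only [objGrad, objHess, cubic, quartic, img_smul, opr_smul, lin_smul, cross_smul_left,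
    cross_smul_right, real_inner_smul_left, real_inner_smul_right]
  ring

lemma objGrad_add_smul (μ : ℝ) (υ u c : Param p q) (t : ℝ) :
    objGrad μ (υ + t • u) c = objGrad μ υ c + t * objHess μ υ u c
      + t ^ 2 * (-cubic υ u u c) + t ^ 3 * (-quartic u c) + t ^ 4 * 0 := by
  rw [objGrad_add_base]
  simp only [objHess, cubic, quartic, img_smul, opr_smul, lin_smul, cross_smul_left,
    cross_smul_right, real_inner_smul_left, real_inner_smul_right]
  ring

lemma objHess_add_smul (μ : ℝ) (υ u a c : Param p q) (t : ℝ) :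
    objHess μ (υ + t • u) a c = objHess μ υ a c + t * (-2 * cubic υ u a c)
      + t ^ 2 * (inner ℝ (cross u a) (cross u c) + 1 / 2 * inner ℝ (cross u u) (cross a c))
      + t ^ 3 * 0 + t ^ 4 * 0 := by
  rw [objHess_add_base]
  simp only [cubic, lin_smul, cross_smul_left, cross_smul_right, real_inner_smul_left,
    real_inner_smul_right]
  ring

lemma cubic_diag_add_smul (υ v c : Param p q) (t : ℝ) :
    1 / 3 * cubic υ (v + t • c) (v + t • c) (v + t • c) = 1 / 3 * cubic υ v v v
      + t * cubic υ v v c + t ^ 2 * cubic υ v c c + t ^ 3 * (1 / 3 * cubic υ c c c)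
      + t ^ 4 * 0 := by
  simp only [cubic, lin_add, lin_smul, cross_add_left, cross_add_right, cross_smul_left,
    cross_smul_right, real_inner_smul_left, real_inner_smul_right, inner_add_left,
    inner_add_right]
  rw [cross_comm c v]
  ring

lemma fderiv_third_cubic (υ v c : Param p q) :
    fderiv ℝ (fun u => 1 / 3 * cubic υ u u u) v c = cubic υ v v c := by
  have hd : ContDiff ℝ ⊤ fun u : Param p q => 1 / 3 * cubic υ u u u := by
    have h := (contDiff_lin_right υ).inner ℝ contDiff_cross_self
    unfold cubic
    exact contDiff_const.mul (contDiff_const.mul ((h.add h).add h))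
  exact fderiv_apply_eq_of_quartic (hd.differentiable (by simp)).differentiableAt
    (cubic_diag_add_smul υ v c)

section Potential

variable {f : Param p q → ℝ} {c₀ μ : ℝ} {η : Param p q}

lemma contDiff_of_eq_sub_obj (hf : ∀ υ, f υ = c₀ + inner ℝ η υ - obj μ υ) : ContDiff ℝ ⊤ f := by
  rw [funext hf]
  exact (contDiff_const.add (contDiff_const.inner ℝ contDiff_id)).sub (contDiff_obj μ)

lemma fderiv_of_eq_sub_obj (hf : ∀ υ, f υ = c₀ + inner ℝ η υ - obj μ υ) (υ c : Param p q) :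
    fderiv ℝ f υ c = inner ℝ η c - objGrad μ υ c := by
  refine fderiv_apply_eq_of_quartic (a₂ := -(1 / 2 * objHess μ υ c c))
    (a₃ := 1 / 3 * cubic υ c c c) (a₄ := 1 / 4 * quartic c c)
    ((contDiff_of_eq_sub_obj hf).differentiable (by simp)).differentiableAt fun t => ?_
  rw [hf, hf, obj_add_smul, inner_add_right, real_inner_smul_right]
  ring

lemma fderiv_fderiv_of_eq_sub_obj (hf : ∀ υ, f υ = c₀ + inner ℝ η υ - obj μ υ)
    (υ u c : Param p q) : fderiv ℝ (fderiv ℝ f) υ u c = -objHess μ υ u c := by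
  have hd : Differentiable ℝ (fderiv ℝ f) :=
    ((contDiff_of_eq_sub_obj hf).fderiv_right (m := 1) (by simp)).differentiable (by simp)
  have h1 : fderiv ℝ (fderiv ℝ f) υ u c = fderiv ℝ (fun y => fderiv ℝ f y c) υ u := by
    rw [fderiv_clm_apply hd.differentiableAt (differentiableAt_const _)]
    simp
  have h2 : (fun y => fderiv ℝ f y c) = fun y => inner ℝ η c - objGrad μ y c :=
    funext fun y => fderiv_of_eq_sub_obj hf y c
  rw [h1, h2, fderiv_const_sub]
  have h3 : fderiv ℝ (fun y : Param p q => objGrad μ y c) υ u = objHess μ υ u c :=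
    fderiv_apply_eq_of_quartic
      ((contDiff_objGrad μ c).differentiable (by simp)).differentiableAt
      (objGrad_add_smul μ υ u c)
  rw [← h3]; rfl

lemma iteratedFDeriv_three_of_eq_sub_obj (hf : ∀ υ, f υ = c₀ + inner ℝ η υ - obj μ υ)
    (υ u : Param p q) : iteratedFDeriv ℝ 3 f υ (fun _ => u) = 2 * cubic υ u u u := by
  have hd : Differentiable ℝ (iteratedFDeriv ℝ 2 f) :=
    (contDiff_of_eq_sub_obj hf).differentiable_iteratedFDeriv (by exact_mod_cast WithTop.coe_lt_top _)
  rw [iteratedFDeriv_succ_apply_left]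
  have h1 := fderiv_continuousMultilinear_apply_const_apply (hd.differentiableAt (x := υ))
    (fun _ => u) u
  have h2 : (fun y => iteratedFDeriv ℝ 2 f y fun _ => u) = fun y => -objHess μ y u u := by
    funext y
    rw [iteratedFDeriv_two_apply, fderiv_fderiv_of_eq_sub_obj hf]
  have h3 : fderiv ℝ (fun y : Param p q => objHess μ y u u) υ u = -2 * cubic υ u u u :=
    fderiv_apply_eq_of_quartic
      ((contDiff_objHess μ u u).differentiable (by simp)).differentiableAt
      (objHess_add_smul μ υ u u u)
  change fderiv ℝ (iteratedFDeriv ℝ 2 f) υ u (fun _ => u) = _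
  rw [← h1, h2, fderiv_fun_neg, neg_apply, h3]
  ring

lemma isLocalMax_objGrad (f : Param p q → ℝ) {P : Param p q →L[ℝ] Param p q}
    (hP : ∀ u v, inner ℝ (P u) v = inner ℝ u (P v))
    (hf : ∀ υ, f υ = c₀ + inner ℝ η υ - obj μ υ - 1 / 2 * inner ℝ (P υ) υ) {υ : Param p q}
    (hmax : IsLocalMax f υ) (c : Param p q) :
    objGrad μ υ c + inner ℝ (P υ) c = inner ℝ η c := by
  have hline : ∀ t : ℝ, f (υ + t • c) = f υ
      + t * (inner ℝ η c - objGrad μ υ c - inner ℝ (P υ) c)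
      + t ^ 2 * (-(1 / 2 * objHess μ υ c c) - 1 / 2 * inner ℝ (P c) c)
      + t ^ 3 * (1 / 3 * cubic υ c c c) + t ^ 4 * (1 / 4 * quartic c c) := by
    intro t
    rw [hf, hf, obj_add_smul, map_add, map_smul]
    simp only [inner_add_left, inner_add_right, real_inner_smul_left, real_inner_smul_right]
    rw [hP c υ, real_inner_comm (P υ) c]
    ring
  have hmax' : IsLocalMax (fun t : ℝ => f (υ + t • c)) 0 := by
    have hc : ContinuousAt (fun t : ℝ => υ + t • c) 0 := by fun_prop
    have h0 : υ + (0 : ℝ) • c = υ := by simp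
    exact IsMaxFilter.comp_tendsto (f := f) (by rw [h0]; exact hmax) (by
      have := hc.tendsto
      rwa [h0] at this)
  have hder := hasDerivAt_quartic_zero (f υ) (inner ℝ η c - objGrad μ υ c - inner ℝ (P υ) c)
    (-(1 / 2 * objHess μ υ c c) - 1 / 2 * inner ℝ (P c) c) (1 / 3 * cubic υ c c c)
    (1 / 4 * quartic c c)
  simp only [← hline] at hder
  linarith [hmax'.hasDerivAt_eq_zero hder]

end Potential

end Calculus

/-! ### The log-likelihood and its expectation -/

section Likelihood

variable {Ω : Type*} {p q : ℕ} (M : Model Ω p q)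

/-- The vector `(0, z, μ² A)` through which the data enter the log-likelihood linearly. -/
noncomputable def dataVec (μ : ℝ) (z : Vec q) (A : Op p q) : Param p q :=
  WithLp.toLp 2 (Sum.elim 0 (Sum.elim z.ofLp (μ ^ 2 • A).ofLp))

lemma inner_dataVec (μ : ℝ) (z : Vec q) (A : Op p q) (υ : Param p q) :
    inner ℝ (dataVec μ z A) υ = inner ℝ z (img υ) + μ ^ 2 * inner ℝ A (opr υ) := by
  have h1 : src (dataVec μ z A) = 0 := rfl
  have h2 : img (dataVec μ z A) = z := rfl
  have h3 : opr (dataVec μ z A) = μ ^ 2 • A := rfl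
  rw [inner_eq_blocks, h1, h2, h3, inner_zero_left, zero_add, real_inner_smul_left]

/-- The part of the log-likelihood that does not depend on the parameter. -/
noncomputable def Model.const (w : Ω) : ℝ :=
  -(1 / 2) * ‖M.Z w‖ ^ 2 - M.mu ^ 2 / 2 * ‖M.Ah w‖ ^ 2

lemma L_eq (w : Ω) (υ : Param p q) :
    M.L w υ = M.const w + inner ℝ (dataVec M.mu (M.Z w) (M.Ah w)) υ - obj M.mu υ := by
  rw [inner_dataVec, Model.L, Model.const, obj, norm_sub_sq_real (M.Z w), norm_sub_sq_real (opr υ),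
    real_inner_comm (M.Ah w)]
  unfold res
  ring

lemma LG_eq (w : Ω) (υ : Param p q) :
    M.LG w υ = M.const w + inner ℝ (dataVec M.mu (M.Z w) (M.Ah w)) υ - obj M.mu υ
      - 1 / 2 * inner ℝ (act M.pen2 υ) υ := by
  rw [Model.LG, L_eq, inner_pen2, real_inner_self_eq_norm_sq, real_inner_self_eq_norm_sq]
  ring

variable [MeasurableSpace Ω] (P : Measure Ω)

/-- The expectation `(0, E Z, μ² E Â)` of the data vector. -/
noncomputable def Model.meanVec : Param p q :=
  dataVec M.mu (∫ w, M.Z w ∂P) (∫ w, M.Ah w ∂P)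

variable [IsProbabilityMeasure P] {M P} (hZ : MemLp M.Z 2 P) (hAh : MemLp M.Ah 2 P)

include hZ hAh

omit [IsProbabilityMeasure P] in
lemma integrable_modelConst : Integrable M.const P :=
  ((hZ.integrable_norm_pow two_ne_zero).const_mul _).sub
    ((hAh.integrable_norm_pow two_ne_zero).const_mul _)

lemma integrable_inner_dataVec (υ : Param p q) :
    Integrable (fun w => inner ℝ (dataVec M.mu (M.Z w) (M.Ah w)) υ) P := by
  simp only [inner_dataVec]
  exact ((hZ.integrable one_le_two).inner_const _).add
    (((hAh.integrable one_le_two).inner_const _).const_mul _)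

lemma integral_inner_dataVec (υ : Param p q) :
    ∫ w, inner ℝ (dataVec M.mu (M.Z w) (M.Ah w)) υ ∂P = inner ℝ (M.meanVec P) υ := by
  have h1 := hZ.integrable one_le_two
  have h2 := hAh.integrable one_le_two
  simp only [Model.meanVec, inner_dataVec]
  rw [integral_add (h1.inner_const _) ((h2.inner_const _).const_mul _), integral_const_mul]
  simp only [real_inner_comm (img υ), real_inner_comm (opr υ)]
  rw [← integral_inner h1, ← integral_inner h2]

lemma EL_eq (υ : Param p q) :
    M.EL P υ = (∫ w, M.const w ∂P) + inner ℝ (M.meanVec P) υ - obj M.mu υ := by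
  have h1 := integrable_modelConst hZ hAh
  have h2 := integrable_inner_dataVec hZ hAh υ
  simp only [Model.EL, L_eq]
  have h12 : Integrable (fun w => M.const w + inner ℝ (dataVec M.mu (M.Z w) (M.Ah w)) υ) P :=
    h1.add h2
  rw [integral_sub h12 (integrable_const (μ := P) _), integral_add h1 h2,
    integral_inner_dataVec hZ hAh]
  simp

lemma ELG_eq (υ : Param p q) :
    M.ELG P υ = (∫ w, M.const w ∂P) + inner ℝ (M.meanVec P) υ - obj M.mu υ
      - 1 / 2 * inner ℝ (act M.pen2 υ) υ := by
  have h : Integrable (fun w => M.L w υ) P := by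
    simp only [L_eq]
    exact ((integrable_modelConst hZ hAh).add (integrable_inner_dataVec hZ hAh υ)).sub
      (integrable_const (μ := P) _)
  rw [← EL_eq hZ hAh, Model.ELG, Model.EL]
  have h2 : ∀ w, M.LG w υ = M.L w υ - 1 / 2 * inner ℝ (act M.pen2 υ) υ := by
    intro w; rw [LG_eq, L_eq]
  simp only [h2]
  rw [integral_sub h (integrable_const (μ := P) _)]
  simp

lemma score_eq (w : Ω) :
    M.score P w = dataVec M.mu (M.Z w) (M.Ah w) - M.meanVec P := by
  refine ext_inner_right ℝ fun c => ?_
  rw [Model.score, inner_gradient_left]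
  have h : ∀ υ, M.L w υ - M.EL P υ = (M.const w - ∫ w, M.const w ∂P)
      + inner ℝ (dataVec M.mu (M.Z w) (M.Ah w) - M.meanVec P) υ := by
    intro υ
    rw [L_eq, EL_eq hZ hAh, inner_sub_left]
    ring
  rw [funext h]
  have hd : Differentiable ℝ fun υ : Param p q => (M.const w - ∫ w, M.const w ∂P)
      + inner ℝ (dataVec M.mu (M.Z w) (M.Ah w) - M.meanVec P) υ :=
    (((innerSL ℝ _).contDiff (n := 1)).differentiable (by simp)).const_add _
  refine fderiv_apply_eq_of_quartic (a₂ := 0) (a₃ := 0) (a₄ := 0) hd.differentiableAt fun t => ?_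
  rw [inner_add_right, real_inner_smul_right]
  ring

lemma inner_info (υ u c : Param p q) : inner ℝ (act (M.info P υ) u) c = objHess M.mu υ u c := by
  have hdecomp : ∀ v : Param p q, v = ∑ i, v i • EuclideanSpace.single i (1 : ℝ) := by
    intro v
    have := (EuclideanSpace.basisFun (Idx p q) ℝ).sum_repr v
    simpa using this.symm
  have hcomm : objHess M.mu υ u c = objHess M.mu υ c u := by
    simp only [objHess]
    rw [cross_comm, real_inner_comm (img u), real_inner_comm (opr u), real_inner_comm (lin υ u)]
  have h : objHess M.mu υ c u = -fderiv ℝ (fderiv ℝ (M.EL P)) υ c u := by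
    rw [fderiv_fderiv_of_eq_sub_obj (EL_eq hZ hAh), neg_neg]
  rw [real_inner_comm, Matrix.inner_toEuclideanCLM, hcomm, h]
  conv_rhs => rw [hdecomp c, hdecomp u]
  simp only [map_sum, map_smul, sum_apply, smul_apply,
    smul_eq_mul, dotProduct, Matrix.mulVec, Model.info, Matrix.of_apply, iteratedFDeriv_two_apply,
    Finset.mul_sum, Matrix.cons_val_zero, Matrix.cons_val_one]
  rw [Finset.sum_comm, ← Finset.sum_neg_distrib]
  refine Finset.sum_congr rfl fun i _ => ?_
  rw [← Finset.sum_neg_distrib]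
  refine Finset.sum_congr rfl fun j _ => ?_
  ring

lemma tens_eq (υ u : Param p q) : M.tens P υ u = 1 / 3 * cubic υ u u u := by
  rw [Model.tens, iteratedFDeriv_three_of_eq_sub_obj (EL_eq hZ hAh)]
  ring

lemma inner_gradient_tens (υ v c : Param p q) :
    inner ℝ (gradient (M.tens P υ) v) c = cubic υ v v c := by
  rw [inner_gradient_left, funext (tens_eq hZ hAh υ), fderiv_third_cubic]

end Likelihood

/-! ### Expansions in the error-in-operator model -/

section Model

variable {Ω : Type*} {p q : ℕ} {M : Model Ω p q}

lemma isLocalMetric_metric [NeZero p] (hmu : 0 < M.mu) {D : Matrix (Fin p) (Fin p) ℝ}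
    (hD : D.PosDef) {δ : ℝ} (hδ0 : 0 ≤ δ) (hδ : δ ≤ 1 / 10) {As : Op p q}
    (hlow : (D * D - (mat As).transpose * mat As).PosSemidef) :
    IsLocalMetric M.mu (M.mu * √(lambdaMin (D * D))) δ (act D) As (act (M.metric D)) := by
  have hDT : D.transpose = D := (Matrix.conjTranspose_eq_transpose_of_trivial D).symm.trans hD.isHermitian
  have hDD : (D * D).PosDef := by
    have h := hD.isUnit
    have := Matrix.PosDef.conjTranspose_mul_self D (Matrix.mulVec_injective_iff_isUnit.2 h)
    rwa [hD.isHermitian] at this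
  have hN := lambdaMin_pos hDD
  have hsq : ∀ α, inner ℝ (act (D * D) α) α = ‖act D α‖ ^ 2 := by
    intro α
    rw [← real_inner_self_eq_norm_sq, ← inner_act_gram, hDT]
  refine ⟨hmu, mul_pos hmu (Real.sqrt_pos.2 hN), hδ0, hδ, norm_sq_metric M D, fun α => ?_,
    fun α => ?_⟩
  · rw [mul_assoc]
    refine mul_le_mul_of_nonneg_left ?_ hmu.le
    refine (abs_le_of_sq_le_sq' ?_ (norm_nonneg _)).2
    have h := inner_act_nonneg (posSemidef_sub_lambdaMin hDD.isHermitian) α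
    rw [act_sub_apply, act_algebraMap_apply, inner_sub_left, hsq, real_inner_smul_left,
      real_inner_self_eq_norm_sq] at h
    rw [mul_pow, Real.sq_sqrt hN.le]
    linarith
  · refine (abs_le_of_sq_le_sq' ?_ (norm_nonneg _)).2
    have h := inner_act_nonneg hlow α
    rw [act_sub_apply, inner_sub_left, hsq, inner_act_gram_mat] at h
    linarith

lemma norm_sq_le_of_posSemidef {D : Matrix (Fin p) (Fin p) ℝ} (hD : D.PosDef) {As : Op p q}
    {G : Matrix (Fin p) (Fin p) ℝ}
    (hup : ((mat As).transpose * mat As + G.transpose * G - D * D).PosSemidef) (α : Vec p) :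
    ‖act D α‖ ^ 2 ≤ ‖app As α‖ ^ 2 + ‖act G α‖ ^ 2 := by
  have hDT : D.transpose = D := (Matrix.conjTranspose_eq_transpose_of_trivial D).symm.trans hD.isHermitian
  have h := inner_act_nonneg hup α
  have h1 := inner_act_gram D α α
  have h2 := inner_act_gram G α α
  rw [hDT, real_inner_self_eq_norm_sq] at h1
  rw [real_inner_self_eq_norm_sq] at h2
  rw [act_sub_apply, act_add_apply, inner_sub_left, inner_add_left, h1, h2,
    inner_act_gram_mat] at h
  linarith

lemma norm_map_src_le {D : Matrix (Fin p) (Fin p) ℝ} (hD : IsUnit D) {F : Type*}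
    [NormedAddCommGroup F] [NormedSpace ℝ F] (Q : Vec p →L[ℝ] F) (e : Param p q) :
    ‖Q (src e)‖ ≤ ‖Q ∘L act D⁻¹‖ * ‖act (M.metric D) e‖ := by
  have h1 := (Q ∘L act D⁻¹).le_opNorm (act D (src e))
  rw [ContinuousLinearMap.comp_apply, act_inv_act hD] at h1
  refine h1.trans (mul_le_mul_of_nonneg_left ?_ (norm_nonneg _))
  refine (abs_le_of_sq_le_sq' ?_ (norm_nonneg _)).2
  rw [norm_sq_metric]
  nlinarith [sq_nonneg ‖img e‖, sq_nonneg (M.mu * ‖opr e‖)]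

variable [MeasurableSpace Ω] {P : Measure Ω} [IsProbabilityMeasure P]
  (hZ : MemLp M.Z 2 P) (hAh : MemLp M.Ah 2 P)
  {m δ : ℝ} {D : Matrix (Fin p) (Fin p) ℝ} {As : Op p q}
  (H : IsLocalMetric M.mu m δ (act D) As (act (M.metric D)))
  (hG : ∀ α, ‖act D α‖ ^ 2 ≤ ‖app As α‖ ^ 2 + ‖act M.G α‖ ^ 2)

include H hG

omit [MeasurableSpace Ω] in
lemma quarter_norm_sq_le_penalized {υ : Param p q} (hυ : υ ∈ opBall m δ (act D) As)
    (u : Param p q) :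
    1 / 4 * ‖act (M.metric D) u‖ ^ 2 ≤ objHess M.mu υ u u + inner ℝ (act M.pen2 u) u := by
  have h := H.quarter_norm_sq_le_objHess hυ u (sq_nonneg ‖act M.G (src u)‖) (hG _)
  rw [inner_pen2, real_inner_self_eq_norm_sq, real_inner_self_eq_norm_sq]
  linarith [sq_nonneg ‖act M.K (opr u)‖]

include hZ hAh

/-- The penalized information matrix is invertible on the local set, since its quadratic form
dominates a quarter of the squared metric; so `infoInv` is a genuine inverse there. -/
lemma inner_infoInv {υ : Param p q} (hυ : υ ∈ opBall m δ (act D) As) (v c : Param p q) :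
    objHess M.mu υ (M.infoInv P υ v) c + inner ℝ (act M.pen2 (M.infoInv P υ v)) c
      = inner ℝ v c := by
  have hform : ∀ u c, inner ℝ (act (M.info P υ + M.pen2) u) c
      = objHess M.mu υ u c + inner ℝ (act M.pen2 u) c := by
    intro u c
    rw [act_add_apply, inner_add_left, inner_info hZ hAh]
  have hunit : IsUnit (M.info P υ + M.pen2) := by
    rw [← Matrix.mulVec_injective_iff_isUnit, ← Matrix.coe_mulVecLin,
      injective_iff_map_eq_zero]
    intro x hx
    have h0 : act (M.info P υ + M.pen2) (WithLp.toLp 2 x) = 0 := by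
      rw [Matrix.toEuclideanCLM_toLp]
      exact congrArg (WithLp.toLp 2) hx
    have h1 := hform (WithLp.toLp 2 x) (WithLp.toLp 2 x)
    rw [h0, inner_zero_left] at h1
    have h2 := quarter_norm_sq_le_penalized H hG hυ (WithLp.toLp 2 x)
    have h3 : ‖act (M.metric D) (WithLp.toLp 2 x)‖ = 0 := by
      rw [← h1] at h2
      exact pow_eq_zero_iff two_ne_zero |>.1 (le_antisymm (by linarith) (sq_nonneg _))
    exact congrArg WithLp.ofLp (H.eq_zero_of_norm_eq_zero h3)
  rw [← hform, Model.infoInv, act_act_inv hunit]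

lemma inner_infoInv_gradient_tens {υ : Param p q} (hυ : υ ∈ opBall m δ (act D) As)
    (v c : Param p q) :
    objHess M.mu υ (M.infoInv P υ (gradient (M.tens P υ) v)) c
      + inner ℝ (act M.pen2 (M.infoInv P υ (gradient (M.tens P υ) v))) c = cubic υ v v c := by
  rw [inner_infoInv hZ hAh H hG hυ, inner_gradient_tens hZ hAh]

omit H hG hZ hAh [IsProbabilityMeasure P] in
lemma corrected_eq (υ a : Param p q) :
    M.corrected P υ a = M.infoInv P υ a
      + M.infoInv P υ (gradient (M.tens P υ) (M.infoInv P υ a)) := map_add _ _ _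

lemma norm_sub_corrected_le {υ υ' a : Param p q} (hυ : υ ∈ opBall m δ (act D) As)
    (hυ' : υ' ∈ opBall m δ (act D) As)
    (hgrad : ∀ c, objGrad M.mu υ' c + inner ℝ (act M.pen2 υ') c
      = objGrad M.mu υ c + inner ℝ (act M.pen2 υ) c + inner ℝ a c)
    (hsmall : 81 / 2 * ‖act (M.metric D) (M.infoInv P υ a)‖ ≤ m) :
    m ^ 2 * ‖act (M.metric D) (υ' - υ - M.corrected P υ a)‖
      ≤ 330 * ‖act (M.metric D) (M.infoInv P υ a)‖ ^ 3 := by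
  rw [corrected_eq, ← sub_sub]
  refine H.norm_sub_expansion_le (pen := fun u c => inner ℝ (act M.pen2 u) c)
    (a := fun c => inner ℝ a c) (fun u v c => by rw [map_sub, inner_sub_left])
    (fun υ hυ u => quarter_norm_sq_le_penalized H hG hυ u) hυ (by simpa using hυ')
    (fun c => ?_) (inner_infoInv hZ hAh H hG hυ a)
    (inner_infoInv_gradient_tens hZ hAh H hG hυ _) hsmall
  rw [add_sub_cancel, map_sub, inner_sub_left]
  linarith [hgrad c]

lemma norm_corrected_sub_le {υ : Param p q} (hυ : υ ∈ opBall m δ (act D) As) (a : Param p q) :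
    m * ‖act (M.metric D) (M.corrected P υ a - M.infoInv P υ a)‖
      ≤ 9 * ‖act (M.metric D) (M.infoInv P υ a)‖ ^ 2 := by
  rw [corrected_eq, add_sub_cancel_left]
  exact H.norm_correction_le (pen := fun u c => inner ℝ (act M.pen2 u) c)
    (fun υ hυ u => quarter_norm_sq_le_penalized H hG hυ u) hυ
    (inner_infoInv_gradient_tens hZ hAh H hG hυ _)

end Model

lemma one_sub_le_of_deviationBound {Ω n : Type*} [MeasurableSpace Ω] [Fintype n] [DecidableEq n]
    {P : Measure Ω} [IsProbabilityMeasure P] {X : Ω → EuclideanSpace ℝ n} {x : ℝ}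
    (h : DeviationBound P X x) (S : EuclideanSpace ℝ n →L[ℝ] EuclideanSpace ℝ n) :
    1 - 3 * Real.exp (-x) ≤ P.real {w | ‖S (X w)‖ ≤ zq (covMat P fun w => S (X w)) x} := by
  have h1 := h S
  -- Subadditivity avoids any measurability of `X`.
  have h2 := measureReal_union_le (μ := P)
    {w | ‖S (X w)‖ ≤ zq (covMat P fun w => S (X w)) x}
    {w | zq (covMat P fun w => S (X w)) x < ‖S (X w)‖}
  have h3 : {w | ‖S (X w)‖ ≤ zq (covMat P fun w => S (X w)) x}
      ∪ {w | zq (covMat P fun w => S (X w)) x < ‖S (X w)‖} = Set.univ := by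
    ext w
    simpa using le_or_gt _ _
  rw [h3, probReal_univ] at h2
  linarith

end EiO

theorem mainTheorem2
    {Ω : Type*} [MeasurableSpace Ω] (P : Measure Ω) [IsProbabilityMeasure P]
    {p q : ℕ} (M : EiO.Model Ω p q) (hmu : 0 < M.mu)
    (hZ : MemLp M.Z 2 P) (hAh : MemLp M.Ah 2 P)
    (D : Matrix (Fin p) (Fin p) ℝ) (hD : D.PosDef)
    (N : ℝ) (hN : N = EiO.lambdaMin (D * D))
    (δ R : ℝ) (hδ0 : 0 < δ) (hδ : δ ≤ 1 / 10) (hR : R = δ * M.mu * √N)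
    -- `υ*` and `υ*_G`: maximizers of `E L` and of `E L_G` lying in the local set
    (υs υG : EiO.Param p q)
    (hυs : IsLocalMax (M.EL P) υs)
    (hυG : IsLocalMax (M.ELG P) υG)
    (hυsΥ : υs ∈ EiO.localSet D (EiO.opr υs) R δ)
    (hυGΥ : υG ∈ EiO.localSet D (EiO.opr υs) R δ)
    -- `A*ᵀ A* ≤ D² ≤ A*ᵀ A* + G²`
    (hDlow : (D * D - (EiO.mat (EiO.opr υs)).transpose * EiO.mat (EiO.opr υs)).PosSemidef)
    (hDup : ((EiO.mat (EiO.opr υs)).transpose * EiO.mat (EiO.opr υs)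
      + M.G.transpose * M.G - D * D).PosSemidef)
    -- the deviation condition for the score
    (x : ℝ) (hx : 0 < x) (hdev : EiO.DeviationBound P (M.score P) x)
    -- `s w = ‖𝒟 F_G⁻¹ ∇ζ‖`, `r = z(Var(𝒟 F_G⁻¹ ∇ζ), x)`, `b = ‖𝒟 F_G⁻¹ 𝒢² υ*‖`
    (s : Ω → ℝ)
    (hs : ∀ w, s w = ‖EiO.act (M.metric D) (M.infoInv P υG (M.score P w))‖)
    (r : ℝ)
    (hr : r = EiO.zq (EiO.covMat P fun w =>
      EiO.act (M.metric D) (M.infoInv P υG (M.score P w))) x)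
    (b : ℝ)
    (hb : b = ‖EiO.act (M.metric D) (M.infoInv P υG (EiO.act M.pen2 υs))‖)
    (hRr : 3 / 2 * max r b ≤ R)
    (h3 : EiO.kap ^ 2 * EiO.tau3 N M.mu * max r b < 4 / 9)
    (h4 : EiO.kap ^ 2 * EiO.tau4 N M.mu * max r b ^ 2 < 1 / 3)
    -- the linear mapping `Q`
    {F : Type*} [NormedAddCommGroup F] [NormedSpace ℝ F] (Q : EiO.Vec p →L[ℝ] F) :
    -- the random set `Ω(x) = {‖𝒟 F_G⁻¹ ∇ζ‖ ≤ r}`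
    1 - 3 * Real.exp (-x) ≤ P.real {w | s w ≤ r} ∧
    (∀ w, s w ≤ r →
      -- expansion of any maximizer `υt` of `L_G` lying in the local set
      (∀ υt ∈ EiO.localSet D (EiO.opr υs) R δ, IsLocalMax (M.LG w) υt →
        ‖Q (EiO.src υt - EiO.src υG - EiO.src (M.corrected P υG (M.score P w)))‖
          ≤ ‖Q ∘L EiO.act D⁻¹‖ * EiO.kap ^ 2
            * (EiO.tau4 N M.mu / 2 + EiO.kap ^ 2 * EiO.tau3 N M.mu ^ 2) * s w ^ 3) ∧
      ‖Q (EiO.src (M.corrected P υG (M.score P w) - M.infoInv P υG (M.score P w)))‖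
        ≤ ‖Q ∘L EiO.act D⁻¹‖ * (EiO.kap ^ 2 * EiO.tau3 N M.mu / 2) * s w ^ 2) ∧
    ‖Q (EiO.src υG - EiO.src υs + EiO.src (M.corrected P υG (EiO.act M.pen2 υs)))‖
      ≤ ‖Q ∘L EiO.act D⁻¹‖ * EiO.kap ^ 2
        * (EiO.tau4 N M.mu / 2 + EiO.kap ^ 2 * EiO.tau3 N M.mu ^ 2) * b ^ 3 ∧
    ‖Q (EiO.src (M.corrected P υG (EiO.act M.pen2 υs)
        - M.infoInv P υG (EiO.act M.pen2 υs)))‖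
      ≤ ‖Q ∘L EiO.act D⁻¹‖ * (EiO.kap ^ 2 * EiO.tau3 N M.mu / 2) * b ^ 2 := by

  have hprob : 1 - 3 * Real.exp (-x) ≤ P.real {w | s w ≤ r} := by
    simp only [hs, hr]
    exact EiO.one_sub_le_of_deviationBound hdev
      (EiO.act (M.metric D) ∘L M.infoInv P υG)
  refine ⟨hprob, ?_⟩
  rcases Nat.eq_zero_or_pos p with rfl | hp
  · -- Here `lambdaMin` is the junk value `sInf ∅ = 0`, but the space of the `θ`-components is trivial.
    have hQ : ∀ y : EiO.Vec 0, ‖Q y‖ = 0 := fun y => by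
      rw [Subsingleton.elim y 0, map_zero, norm_zero]
    have hQD : ‖Q ∘L EiO.act D⁻¹‖ = 0 := by
      rw [norm_eq_zero]
      ext y
      exact norm_eq_zero.1 (hQ _)
    simp only [hQ, hQD]
    simp
  have : NeZero p := ⟨hp.ne'⟩
  subst hN
  have H := EiO.isLocalMetric_metric (M := M) hmu hD hδ0.le hδ hDlow
  have hG := EiO.norm_sq_le_of_posSemidef hD hDup
  set m := M.mu * √(EiO.lambdaMin (D * D)) with hm
  have hm0 : 0 < m := H.m_pos
  have hNpos : 0 < √(EiO.lambdaMin (D * D)) := pos_of_mul_pos_right hm0 hmu.le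
  have hm2 : m ^ 2 = EiO.lambdaMin (D * D) * M.mu ^ 2 := by
    rw [hm, mul_pow, Real.sq_sqrt (Real.sqrt_pos.1 hNpos).le, mul_comm]
  have ht3 : EiO.tau3 (EiO.lambdaMin (D * D)) M.mu = 9 / 2 / m := by
    rw [EiO.tau3, hm, mul_comm M.mu]; norm_num
  have ht4 : EiO.tau4 (EiO.lambdaMin (D * D)) M.mu = 3 / m ^ 2 := by
    rw [EiO.tau4, hm2]
  rw [ht3] at h3
  rw [ht3, ht4]
  have hmax : 81 / 2 * max r b ≤ m := by
    have h5 : EiO.kap ^ 2 * (9 / 2 / m) * max r b = 18 * max r b / m := by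
      rw [EiO.kap]; ring
    rw [h5, div_lt_iff₀ hm0] at h3
    linarith
  have hsub : EiO.localSet D (EiO.opr υs) R δ
      ⊆ EiO.opBall m δ (EiO.act D) (EiO.opr υs) := by
    rw [hR, mul_assoc]
    exact EiO.localSet_subset_opBall hD.isUnit
  have hυs' := hsub hυsΥ
  have hυG' := hsub hυGΥ
  have hpen : ∀ u v, inner ℝ (EiO.act M.pen2 u) v = inner ℝ u (EiO.act M.pen2 v) := by
    intro u v
    rw [← real_inner_comm u, EiO.inner_pen2, EiO.inner_pen2,
      real_inner_comm (EiO.act M.G _), real_inner_comm (EiO.act M.K _)]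
  have hgradG : ∀ c, EiO.objGrad M.mu υG c + inner ℝ (EiO.act M.pen2 υG) c
      = inner ℝ (M.meanVec P) c :=
    EiO.isLocalMax_objGrad _ hpen (EiO.ELG_eq hZ hAh) hυG
  have hgrads : ∀ c, EiO.objGrad M.mu υs c = inner ℝ (M.meanVec P) c := by
    intro c
    have h := EiO.isLocalMax_objGrad (P := 0) (M.EL P) (by simp)
      (fun υ => by simpa using EiO.EL_eq hZ hAh υ) hυs c
    simpa using h
  -- The bounds in the metric `𝒟` transfer to `Q`.
  have hcubic : ∀ (e : EiO.Param p q) (t : ℝ), m ^ 2 * ‖EiO.act (M.metric D) e‖ ≤ 330 * t ^ 3 →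
      ‖Q (EiO.src e)‖ ≤ ‖Q ∘L EiO.act D⁻¹‖ * EiO.kap ^ 2
        * (3 / m ^ 2 / 2 + EiO.kap ^ 2 * (9 / 2 / m) ^ 2) * t ^ 3 := by
    intro e t he
    refine (EiO.norm_map_src_le (M := M) hD.isUnit Q e).trans ?_
    have h : ‖EiO.act (M.metric D) e‖ ≤ 330 * t ^ 3 / m ^ 2 := by
      rwa [le_div_iff₀ (by positivity), mul_comm]
    refine (mul_le_mul_of_nonneg_left h (norm_nonneg _)).trans_eq ?_
    rw [EiO.kap]; field_simp; ring
  have hquad : ∀ (e : EiO.Param p q) (t : ℝ), m * ‖EiO.act (M.metric D) e‖ ≤ 9 * t ^ 2 →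
      ‖Q (EiO.src e)‖ ≤ ‖Q ∘L EiO.act D⁻¹‖ * (EiO.kap ^ 2 * (9 / 2 / m) / 2) * t ^ 2 := by
    intro e t he
    refine (EiO.norm_map_src_le (M := M) hD.isUnit Q e).trans ?_
    have h : ‖EiO.act (M.metric D) e‖ ≤ 9 * t ^ 2 / m := by
      rwa [le_div_iff₀ hm0, mul_comm]
    refine (mul_le_mul_of_nonneg_left h (norm_nonneg _)).trans_eq ?_
    rw [EiO.kap]; field_simp
  refine ⟨fun w hw => ⟨fun υt hυt hmaxt => ?_, ?_⟩, ?_, ?_⟩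
  · rw [← EiO.src_sub, ← EiO.src_sub]
    apply hcubic
    rw [hs w]
    refine EiO.norm_sub_corrected_le hZ hAh H hG hυG' (hsub hυt) (fun c => ?_) ?_
    · rw [EiO.isLocalMax_objGrad _ hpen (EiO.LG_eq M w) hmaxt, hgradG,
        EiO.score_eq hZ hAh, inner_sub_left]
      ring
    · rw [← hs w]
      linarith [le_max_left r b]
  · apply hquad
    rw [hs w]
    exact EiO.norm_corrected_sub_le hZ hAh H hG hυG' _
  · have h : EiO.src υG - EiO.src υs + EiO.src (M.corrected P υG (EiO.act M.pen2 υs))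
        = -EiO.src (υs - υG - M.corrected P υG (EiO.act M.pen2 υs)) := by
      rw [EiO.src_sub, EiO.src_sub]; abel
    rw [h, map_neg, norm_neg]
    apply hcubic
    rw [hb]
    refine EiO.norm_sub_corrected_le hZ hAh H hG hυG' hυs' (fun c => ?_) ?_
    · rw [hgradG, hgrads]
    · rw [← hb]
      linarith [le_max_right r b]
  · apply hquad
    rw [hb]
    exact EiO.norm_corrected_sub_le hZ hAh H hG hυG' _
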